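/- Definitions. The given graphs $G$ are simple and finite. Let $G=(V,E)$ be a directed graph. A shortcut of $G$ with diameter $D$ is a set $H$ of additional directed edges (no self-loops, $H\cap E=\emptyset$) such that $G\cup H$ has the same reachability relation as $G$, and whenever $t$ is reachable from $s$ in $G$, $t$ can be reached from $s$ in $G\cup H$ using at most $D$ edges. A shortcut $H$ (of any diameter) is certified if for every $(u,v)\in H$ there is $w\in V$ with $(u,w),(w,v)\in E\cup H$. The certification complexity of a shortcut $H$ is the smallest size of a certified shortcut $H'\supseteq H$. Let $G=(V,E)$ be an unweighted undirected graph (each edge has weight $1$). A hopset of $G$ with diameter $D$ is a finite set $H$ of additional undirected edges with nonnegative real weights (no self-loops, no edge of $E$ with weight $1$; parallel edges of different weights are allowed) such that $\mathrm{dist}_{G\cup H}(s,t)=\mathrm{dist}_G(s,t)$ for all $s,t\in V$, and whenever this distance is finite it is attained by an $s$-$t$ path in $G\cup H$ with at most $D$ edges. A hopset $H$ (of any diameter) is certified if for every edge $\{u,v\}$ of weight $\omega$ in $H$ there are $x \in V$ and edges $\{u,x\},\{x,v\}$ of $G\cup H$ whose weights add up to $\omega$. The certification complexity of a hopset $H$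 is the smallest size of a certified hopset $H'\supseteq H$. Ullman–Yannakakis sampling. Given an $n$-vertex graph and $p_n\in[0,1]$, let $R$ contain each vertex independently with probability $p_n$, where $p_n=\tilde\Theta(n^{-1/2})$ (that is, up to constant and polylogarithmic factors in $n$). For a directed graph, the sampling shortcut consists of all pairs $(u,v)\notin E$ of distinct vertices $u,v\in R$ such that $v$ is reachable from $u$. For an undirected graph, the sampling hopset consists of all pairs $\{u,v\}\notin E$ of distinct vertices $u,v\in R$ that are connected in $G$, with weight $\mathrm{dist}_G(u,v)$. An event holds with high probability if for every $a\in\mathbb N$ its probability is at least $1-n^{-a}$ for all sufficiently large $n$. Theorem. Let $\epsilon\in[0,1/25)$. (1) There are DAGs $(G_n)_{n\in\mathbb N}$, where $G_n$ has $n$ vertices and $m_n=\Theta(n^{1+\epsilon})$ edges, and a constant $c>0$ such that for every choice of sampling probabilities $p_n=\tilde\Theta(n^{-1/2})$, with high probability the Ullman–Yannakakis sampling shortcut of $G_n$ has certification complexity at least $c\,m_n n^{\epsilon}$. (2) There are unweighted undirected graphs $(G_n)_{n\in\mathbb N}$, where $G_n$ has $n$ vertices and $m_n=\Theta(n^{1+\epsilon})$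 edges, and a constant $c>0$ such that for every choice of sampling probabilities $p_n=\tilde\Theta(n^{-1/2})$, with high probability the Ullman–Yannakakis sampling hopset of $G_n$ has certification complexity at least $c\,m_n n^{\epsilon}$. The constants may depend on $\epsilon$; the graphs and $c$ do not depend on $(p_n)$. -/

import Mathlib

open Filter Asymptotics
open scoped ENNReal NNReal

namespace Certification

variable {V : Type*}

/-! ### Directed graphs and shortcuts -/

/-- A directed graph is a DAG if no vertex can reach itself by a nonempty walk. -/
def IsDAG (G : Digraph V) : Prop := ∀ v, ¬ Relation.TransGen G.Adj v v

/-- The number of edges of a directed graph. -/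
noncomputable def numArcs (G : Digraph V) : ℕ := {q : V × V | G.Adj q.1 q.2}.ncard

/-- `t` is reachable from `s`. -/
def Reaches (G : Digraph V) (s t : V) : Prop := Relation.ReflTransGen G.Adj s t

/-- `StepsTo G k s t`: there is a walk from `s` to `t` with exactly `k` edges. -/
inductive StepsTo (G : Digraph V) : ℕ → V → V → Prop
  | nil (s : V) : StepsTo G 0 s s
  | cons {k : ℕ} {s v t : V} : G.Adj s v → StepsTo G k v t → StepsTo G (k + 1) s t

/-- The graph `G ∪ H`. -/
def addArcs (G : Digraph V) (H : Finset (V × V)) : Digraph V :=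
  ⟨fun u v => G.Adj u v ∨ (u, v) ∈ H⟩

/-- `H` is a shortcut of `G` with diameter `D`: a set of additional edges (no self-loops, and none
of them is already an edge of `G`) that does not change reachability and such that every reachable
pair is joined by at most `D` edges of `G ∪ H`. -/
structure IsShortcut (G : Digraph V) (D : ℕ) (H : Finset (V × V)) : Prop where
  additional : ∀ u v, (u, v) ∈ H → u ≠ v ∧ ¬ G.Adj u v
  not_reaches : ∀ s t, ¬ Reaches G s t → ¬ Reaches (addArcs G H) s t
  diameter : ∀ s t, Reaches G s t → ∃ k ≤ D, StepsTo (addArcs G H) k s t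

/-- `H` is a certified shortcut of `G` (of some diameter): every edge `(u, v)` of `H` comes with
two edges `(u, w)`, `(w, v)` of `G ∪ H`. -/
structure IsCertifiedShortcut (G : Digraph V) (H : Finset (V × V)) : Prop where
  shortcut : ∃ D, IsShortcut G D H
  certified : ∀ u v, (u, v) ∈ H → ∃ w, (addArcs G H).Adj u w ∧ (addArcs G H).Adj w v

/-- The certification complexity of a shortcut `H`: the smallest size of a certified shortcut
containing `H`. -/
noncomputable def shortcutCertComplexity (G : Digraph V) (H : Finset (V × V)) : ℕ :=
  sInf {k : ℕ | ∃ H' : Finset (V × V), H ⊆ H' ∧ IsCertifiedShortcut G H' ∧ H'.card = k}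

open Classical in
/-- The sampling shortcut of Ullman and Yannakakis on the sampled vertex set `R`: add a new edge
from every sampled vertex to any other sampled vertex reachable from it. -/
noncomputable def samplingShortcut [Fintype V] (G : Digraph V) (R : Set V) : Finset (V × V) :=
  {q : V × V | q.1 ∈ R ∧ q.2 ∈ R ∧ q.1 ≠ q.2 ∧ Reaches G q.1 q.2 ∧ ¬ G.Adj q.1 q.2}

/-! ### Unweighted undirected graphs and hopsets

The edges of `G` have weight `1`; a set of weighted edges is a finite set of pairs consisting of an
unordered pair of vertices and a weight. -/

/-- `G ∪ H` has an edge of weight `w` between `u` and `v`. -/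
def WeightedAdj (G : SimpleGraph V) (H : Finset (Sym2 V × ℝ≥0)) (u v : V) (w : ℝ≥0) : Prop :=
  (G.Adj u v ∧ w = 1) ∨ (s(u, v), w) ∈ H

/-- `WeightedWalk G H k l s t`: there is a walk from `s` to `t` in `G ∪ H` with exactly `k` edges
and total weight `l`. -/
inductive WeightedWalk (G : SimpleGraph V) (H : Finset (Sym2 V × ℝ≥0)) :
    ℕ → ℝ≥0 → V → V → Prop
  | nil (s : V) : WeightedWalk G H 0 0 s s
  | cons {k : ℕ} {w l : ℝ≥0} {s v t : V} :
      WeightedAdj G H s v w → WeightedWalk G H k l v t → WeightedWalk G H (k + 1) (w + l) s t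

/-- The distance from `s` to `t` in `G ∪ H`, infinite if there is no walk. -/
noncomputable def weightedDist (G : SimpleGraph V) (H : Finset (Sym2 V × ℝ≥0)) (s t : V) : ℝ≥0∞ :=
  ⨅ (k : ℕ) (l : ℝ≥0) (_ : WeightedWalk G H k l s t), (l : ℝ≥0∞)

/-- `H` is an exact hopset of `G` with diameter `D`: a set of additional weighted edges (no
self-loops, and none of them is already an edge of `G`) that preserves all distances and such that
every finite distance is attained by a path with at most `D` edges of `G ∪ H`. -/
structure IsHopset (G : SimpleGraph V) (D : ℕ) (H : Finset (Sym2 V × ℝ≥0)) : Prop where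
  additional : ∀ e w, (e, w) ∈ H → ¬ e.IsDiag ∧ ¬ (e ∈ G.edgeSet ∧ w = 1)
  dist_eq : ∀ s t, weightedDist G H s t = (G.edist s t : ℝ≥0∞)
  diameter : ∀ s t, G.Reachable s t → ∃ k ≤ D, WeightedWalk G H k (G.dist s t : ℝ≥0) s t

/-- `H` is a certified hopset of `G` (of some diameter): every edge `(u, v)` of `H` comes with
two edges `(u, x)`, `(x, v)` of `G ∪ H` whose weights add up to the weight of `(u, v)`. -/
structure IsCertifiedHopset (G : SimpleGraph V) (H : Finset (Sym2 V × ℝ≥0)) : Prop where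
  hopset : ∃ D, IsHopset G D H
  certified : ∀ u v w, (s(u, v), w) ∈ H →
    ∃ x w₁ w₂, WeightedAdj G H u x w₁ ∧ WeightedAdj G H x v w₂ ∧ w = w₁ + w₂

/-- The certification complexity of a hopset `H`: the smallest size of a certified hopset
containing `H`. -/
noncomputable def hopsetCertComplexity (G : SimpleGraph V) (H : Finset (Sym2 V × ℝ≥0)) : ℕ :=
  sInf {k : ℕ | ∃ H' : Finset (Sym2 V × ℝ≥0), H ⊆ H' ∧ IsCertifiedHopset G H' ∧ H'.card = k}

open Classical in
/-- The sampling hopset of Ullman and Yannakakis on the sampled vertex set `R`: add a new edge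
between any two distinct sampled vertices connected in `G`, with weight their distance in `G`. -/
noncomputable def samplingHopset [Fintype V] (G : SimpleGraph V) (R : Set V) :
    Finset (Sym2 V × ℝ≥0) :=
  Finset.image (fun q : V × V => (s(q.1, q.2), (G.dist q.1 q.2 : ℝ≥0)))
    {q : V × V | q.1 ∈ R ∧ q.2 ∈ R ∧ q.1 ≠ q.2 ∧ G.Reachable q.1 q.2 ∧ ¬ G.Adj q.1 q.2}

/-! ### Asymptotics and probability -/

/-- `f = Θ̃(g)`: equality up to constant and polylogarithmic factors. -/
def IsSoftTheta (f g : ℕ → ℝ) : Prop :=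
  ∃ k : ℕ, f =O[atTop] (fun n => g n * Real.log n ^ k) ∧
    g =O[atTop] (fun n => f n * Real.log n ^ k)

/-- When each of the `n` vertices is sampled independently with probability `p n`, the set of
sampled vertices has the property `A n` with high probability: the failure probability is
eventually below every inverse polynomial. -/
def SampledWHP (p : ℕ → unitInterval) (A : ∀ n : ℕ, Set (Set (Fin n))) : Prop :=
  ∀ a : ℕ, ∀ᶠ n : ℕ in atTop,
    1 - ((n : ℝ) ^ a)⁻¹ ≤ (ProbabilityTheory.setBernoulli Set.univ (p n)).real (A n)

end Certification

/-! The graph is a levelled DAG containing about n^(1-o(1)) pairs (tail, tail), each to be crossed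
through a long core. Tails are paths with n^(1/2+1/2000) vertices, so with high probability sampling
hits every tail and the sampling set contains a pair from the start tail to the end tail of every κ.
Lower bound. In a certified set each pair splits into two shorter pairs, down to arcs. A pair
crossing M core levels is the root of a binary tree, in which at least M - 1 pairs climb at least
two core levels (`IsCertifiedPairs.coverage_le`). If two consecutive core arcs on a path for κ
determine κ, trees of different κ share no such pair, and the set has at least |I| (M - 1) elements
(`IsRigidSystem.card_mul_le`). In the underlying undirected graph, hopset edges whose weight equals
their level gain behave like reachable pairs, so the same bound holds for hopsets. Construction. Few
tails must serve many pairs: core c joins tail c + a to tail c + 2a, for a in a set A free of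
three-term progressions. Another core joining the same two tails would produce a progression, so the
N|A| pairs need only 5N tails. Inside a core the path of a alternates between two slopes; a
quadratic coordinate makes it the unique path between its ends (`two_alternating_slopes_rigid`). Two
consecutive arcs reveal both slopes, so J² slope pairs are available per starting point: paths may
share vertices and single arcs but not two consecutive arcs. Counting. With J of order n^ε and L
N|A| of order n^(1+2ε), the core has about L N|A| / J² vertices, which fits into n, and J times as
many arcs, so m is of order n^(1+ε), while the certification cost is at least n^(1+2ε). Behrend's
bound supplies a large enough A. -/

namespace Certification

/-! ### Levelled digraphs and the counting bound for certified sets -/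

section Levelled

variable {V I : Type*} {G : Digraph V} {lev : V → ℕ}

/-- Every arc of `G` raises the level by exactly one. -/
def IsLevelling (G : Digraph V) (lev : V → ℕ) : Prop :=
  ∀ ⦃x y⦄, G.Adj x y → lev y = lev x + 1

theorem IsLevelling.le_of_reaches (hl : IsLevelling G lev) {x y : V} (h : Reaches G x y) :
    lev x ≤ lev y := by
  induction h with
  | refl => exact le_rfl
  | tail _ h ih => have := hl h; omega

theorem IsLevelling.lt_of_reaches (hl : IsLevelling G lev) {x y : V} (h : Reaches G x y)
    (hne : x ≠ y) : lev x < lev y := by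
  rcases Relation.ReflTransGen.cases_head h with h | ⟨w, hw, h⟩
  · exact absurd h hne
  · have := hl hw
    have := hl.le_of_reaches h
    omega

theorem IsLevelling.isDAG (hl : IsLevelling G lev) : IsDAG G := by
  intro v hv
  obtain ⟨w, hw, h⟩ := Relation.TransGen.head'_iff.1 hv
  have := hl hw
  have := hl.le_of_reaches h
  omega

theorem IsLevelling.exists_level_eq (hl : IsLevelling G lev) {x y : V} (h : Reaches G x y) {i : ℕ}
    (hi : lev x ≤ i) (hi' : i ≤ lev y) :
    ∃ w, lev w = i ∧ Reaches G x w ∧ Reaches G w y := by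
  induction h using Relation.ReflTransGen.head_induction_on with
  | refl => exact ⟨y, by omega, .refl, .refl⟩
  | @head x w hxw hwy ih =>
    by_cases hx : lev x = i
    · exact ⟨x, hx, .refl, .head hxw hwy⟩
    · obtain ⟨z, hz, h1, h2⟩ := ih (by have := hl hxw; omega)
      exact ⟨z, hz, .head hxw h1, h2⟩

theorem IsLevelling.exists_consecutive (hl : IsLevelling G lev) {x y : V} (h : Reaches G x y)
    {i : ℕ} (hi : lev x ≤ i) (hi' : i + 2 ≤ lev y) :
    ∃ w₀ w₁ w₂, lev w₀ = i ∧ Reaches G x w₀ ∧ G.Adj w₀ w₁ ∧ G.Adj w₁ w₂ ∧ Reaches G w₂ y := by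
  obtain ⟨w₀, h0, hx, hy⟩ := hl.exists_level_eq h hi (by omega)
  rcases Relation.ReflTransGen.cases_head hy with rfl | ⟨w₁, h1, hy⟩
  · omega
  have e1 := hl h1
  rcases Relation.ReflTransGen.cases_head hy with rfl | ⟨w₂, h2, hy⟩
  · omega
  exact ⟨w₀, w₁, w₂, h0, hx, h1, h2, hy⟩

/-- A family of source sets `A κ` and target sets `B κ` such that three consecutive vertices in the
levels from `lo` to `lo + M` lie on a path from `A κ` to `B κ` for at most one `κ`. -/
structure IsRigidSystem (G : Digraph V) (lev : V → ℕ) (A B : I → Set V) (lo M : ℕ) : Prop where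
  levelling : IsLevelling G lev
  source : ∀ κ, ∀ u ∈ A κ, lev u ≤ lo
  target : ∀ κ, ∀ v ∈ B κ, lo + M ≤ lev v
  reaches : ∀ κ, ∀ u ∈ A κ, ∀ v ∈ B κ, Reaches G u v
  separated : ∀ κ κ' w₀ w₁ w₂, G.Adj w₀ w₁ → G.Adj w₁ w₂ → lo ≤ lev w₀ → lev w₂ ≤ lo + M →
    (∃ u ∈ A κ, ∃ v ∈ B κ, Reaches G u w₀ ∧ Reaches G w₂ v) →
    (∃ u ∈ A κ', ∃ v ∈ B κ', Reaches G u w₀ ∧ Reaches G w₂ v) → κ = κ'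

/-- The number of levels between `lo` and `lo + M` that a path from `x` to `y` climbs. -/
def coverage (lev : V → ℕ) (lo M : ℕ) (x y : V) : ℕ := min (lev y) (lo + M) - max (lev x) lo

open Classical in
/-- The pairs in `T` between `x` and `y` that climb at least two levels of the core. -/
noncomputable def innerPairs (G : Digraph V) (lev : V → ℕ) (lo M : ℕ) (T : Finset (V × V))
    (x y : V) : Finset (V × V) :=
  {q ∈ T | Reaches G x q.1 ∧ Reaches G q.2 y ∧ 2 ≤ coverage lev lo M q.1 q.2}

/-- Every pair of `T` is joined by a path, and is the composition of two pairs which are arcs or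
belong to `T`. -/
structure IsCertifiedPairs (G : Digraph V) (T : Finset (V × V)) : Prop where
  reaches : ∀ q ∈ T, Reaches G q.1 q.2
  ne : ∀ q ∈ T, q.1 ≠ q.2
  certified : ∀ q ∈ T, ∃ w, (G.Adj q.1 w ∨ (q.1, w) ∈ T) ∧ (G.Adj w q.2 ∨ (w, q.2) ∈ T)

/-- A binary tree with c leaves has c - 1 inner nodes. A pair of coverage at least two is not an
arc, so it splits at its certificate; coverage is subadditive under splitting, the inner pairs of
the two halves are disjoint, and the pair itself lies in neither half. -/
theorem IsCertifiedPairs.coverage_le {T : Finset (V × V)} (hT : IsCertifiedPairs G T)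
    (hl : IsLevelling G lev) (lo M : ℕ) {x y : V} (hxy : G.Adj x y ∨ (x, y) ∈ T) :
    coverage lev lo M x y ≤ (innerPairs G lev lo M T x y).card + 1 := by
  classical
  have key : ∀ {x y : V}, (G.Adj x y ∨ (x, y) ∈ T) → Reaches G x y ∧ lev x < lev y := by
    rintro x y (h | h)
    · exact ⟨.single h, by have := hl h; omega⟩
    · exact ⟨hT.reaches _ h, hl.lt_of_reaches (hT.reaches _ h) (hT.ne _ h)⟩
  induction hd : lev y - lev x using Nat.strong_induction_on generalizing x y with
  | _ d ih =>
  by_cases hc : coverage lev lo M x y ≤ 1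
  · omega
  have hxyT : (x, y) ∈ T := by
    refine hxy.resolve_left fun h => hc ?_
    have := hl h
    unfold coverage
    omega
  obtain ⟨w, h1, h2⟩ := hT.certified _ hxyT
  dsimp only at h1 h2
  obtain ⟨r1, l1⟩ := key h1
  obtain ⟨r2, l2⟩ := key h2
  have i1 := ih _ (by omega) h1 rfl
  have i2 := ih _ (by omega) h2 rfl
  have hdis : Disjoint (innerPairs G lev lo M T x w) (innerPairs G lev lo M T w y) := by
    rw [Finset.disjoint_left]
    intro q hq hq'
    simp only [innerPairs, Finset.mem_filter] at hq hq'
    have := hl.le_of_reaches hq.2.2.1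
    have := hl.le_of_reaches hq'.2.1
    have := (key (Or.inr hq.1)).2
    omega
  have hnot : (x, y) ∉ innerPairs G lev lo M T x w ∪ innerPairs G lev lo M T w y := by
    simp only [innerPairs, Finset.mem_union, Finset.mem_filter, not_or]
    constructor
    · rintro ⟨-, -, h, -⟩
      have := hl.le_of_reaches h
      omega
    · rintro ⟨-, h, -⟩
      have := hl.le_of_reaches h
      omega
  have hsub : insert (x, y) (innerPairs G lev lo M T x w ∪ innerPairs G lev lo M T w y) ⊆
      innerPairs G lev lo M T x y := by
    intro q hq
    simp only [innerPairs, Finset.mem_insert, Finset.mem_union, Finset.mem_filter] at hq ⊢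
    rcases hq with rfl | ⟨h, h3, h4, h5⟩ | ⟨h, h3, h4, h5⟩
    · exact ⟨hxyT, .refl, .refl, by dsimp only; omega⟩
    · exact ⟨h, h3, h4.trans r2, h5⟩
    · exact ⟨h, r1.trans h3, h4, h5⟩
  have hcard := Finset.card_le_card hsub
  rw [Finset.card_insert_of_notMem hnot, Finset.card_union_of_disjoint hdis] at hcard
  have : coverage lev lo M x y ≤ coverage lev lo M x w + coverage lev lo M w y := by
    unfold coverage
    omega
  omega

/-- Each κ owns a pair of `T` of full coverage M, hence M - 1 inner pairs. A path realizing an inner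
pair has two consecutive arcs in the core, which by separation identify κ, so nothing is counted
twice. -/
theorem IsRigidSystem.card_mul_le [Fintype I] {A B : I → Set V} {lo M : ℕ}
    (h : IsRigidSystem G lev A B lo M) {T : Finset (V × V)} (hT : IsCertifiedPairs G T)
    (hA : ∀ κ, ∃ u ∈ A κ, ∃ v ∈ B κ, (u, v) ∈ T) :
    Fintype.card I * (M - 1) ≤ T.card := by
  classical
  choose u hu v hv huv using hA
  have hcov : ∀ κ, M - 1 ≤ (innerPairs G lev lo M T (u κ) (v κ)).card := by
    intro κ
    have h1 := hT.coverage_le h.levelling lo M (Or.inr (huv κ))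
    have h2 := h.source κ _ (hu κ)
    have h3 := h.target κ _ (hv κ)
    unfold coverage at h1
    omega
  have hdis : (Set.univ : Set I).PairwiseDisjoint
      fun κ => innerPairs G lev lo M T (u κ) (v κ) := by
    intro κ _ κ' _ hne
    refine Finset.disjoint_left.2 fun q hq hq' => hne ?_
    simp only [innerPairs, Finset.mem_filter] at hq hq'
    have hc := hq.2.2.2
    unfold coverage at hc
    obtain ⟨w₀, w₁, w₂, e0, r0, a1, a2, r2⟩ := h.levelling.exists_consecutive (hT.reaches q hq.1)
      (i := max (lev q.1) lo) (le_max_left _ _) (by omega)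
    have l1 := h.levelling a1
    have l2 := h.levelling a2
    exact h.separated κ κ' w₀ w₁ w₂ a1 a2 (by omega) (by omega)
      ⟨_, hu κ, _, hv κ, hq.2.1.trans r0, r2.trans hq.2.2.1⟩
      ⟨_, hu κ', _, hv κ', hq'.2.1.trans r0, r2.trans hq'.2.2.1⟩
  calc Fintype.card I * (M - 1) = ∑ _κ : I, (M - 1) := by simp
    _ ≤ ∑ κ, (innerPairs G lev lo M T (u κ) (v κ)).card := Finset.sum_le_sum fun κ _ => hcov κ
    _ = (Finset.univ.biUnion fun κ => innerPairs G lev lo M T (u κ) (v κ)).card :=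
        (Finset.card_biUnion (by simpa using hdis)).symm
    _ ≤ T.card := Finset.card_le_card <| Finset.biUnion_subset.2 fun κ _ =>
        Finset.filter_subset _ _

end Levelled

/-! ### Transfer to shortcuts -/

section Shortcut

variable {V I : Type*} {G : Digraph V} {lev : V → ℕ}

theorem reaches_of_addArcs {H : Finset (V × V)} (hH : ∀ u v, (u, v) ∈ H → Reaches G u v) {s t : V}
    (h : Reaches (addArcs G H) s t) : Reaches G s t := by
  induction h with
  | refl => exact .refl
  | tail _ h ih =>
    rcases h with h | h
    · exact ih.tail h
    · exact ih.trans (hH _ _ h)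

/-- The transitive closure is certified by peeling off the first arc of a path. This makes the set
in the definition of the complexity nonempty; an empty infimum would be 0 and no lower bound could
hold. -/
theorem isCertifiedShortcut_samplingShortcut_univ [Fintype V] (G : Digraph V) :
    IsCertifiedShortcut G (samplingShortcut G Set.univ) where
  shortcut := by
    refine ⟨1, ⟨fun u v h => ?_, fun s t h h' => h ?_, fun s t h => ?_⟩⟩
    · simp only [samplingShortcut, Finset.mem_filter, Finset.mem_univ, Set.mem_univ, true_and] at h
      exact ⟨h.1, h.2.2⟩
    · refine reaches_of_addArcs (fun u v h => ?_) h'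
      simp only [samplingShortcut, Finset.mem_filter, Finset.mem_univ, Set.mem_univ, true_and] at h
      exact h.2.1
    · by_cases hst : s = t
      · exact ⟨0, by omega, hst ▸ .nil s⟩
      · refine ⟨1, le_rfl, .cons ?_ (.nil t)⟩
        by_cases ha : G.Adj s t
        · exact Or.inl ha
        · right
          simp only [samplingShortcut, Finset.mem_filter, Finset.mem_univ, Set.mem_univ, true_and]
          exact ⟨hst, h, ha⟩
  certified := by
    intro u v h
    simp only [samplingShortcut, Finset.mem_filter, Finset.mem_univ, Set.mem_univ, true_and] at h
    obtain ⟨hne, hr, ha⟩ := h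
    rcases Relation.ReflTransGen.cases_head hr with h | ⟨w, hw, h⟩
    · exact absurd h hne
    · refine ⟨w, Or.inl hw, ?_⟩
      by_cases hwv : G.Adj w v
      · exact Or.inl hwv
      · right
        simp only [samplingShortcut, Finset.mem_filter, Finset.mem_univ, Set.mem_univ, true_and]
        refine ⟨?_, h, hwv⟩
        rintro rfl
        exact ha hw

theorem IsRigidSystem.le_shortcutCertComplexity [Fintype V] [Fintype I] {A B : I → Set V}
    {lo M : ℕ} (h : IsRigidSystem G lev A B lo M) (hM : 2 ≤ M) {R : Set V}
    (hA : ∀ κ, ∃ u ∈ A κ, u ∈ R) (hB : ∀ κ, ∃ v ∈ B κ, v ∈ R) :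
    Fintype.card I * (M - 1) ≤ shortcutCertComplexity G (samplingShortcut G R) := by
  have hl := h.levelling
  refine le_csInf ⟨_, _, fun q hq => ?_, isCertifiedShortcut_samplingShortcut_univ G, rfl⟩ ?_
  · simp only [samplingShortcut, Finset.mem_filter, Finset.mem_univ, Set.mem_univ, true_and] at hq ⊢
    exact hq.2.2
  rintro _ ⟨H, hsub, ⟨⟨D, hD⟩, hcert⟩, rfl⟩
  refine h.card_mul_le ⟨fun q hq => ?_, fun q hq => (hD.additional _ _ hq).1,
    fun q hq => hcert _ _ hq⟩ fun κ => ?_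
  · by_contra hn
    exact hD.not_reaches _ _ hn (.single (Or.inr hq))
  · obtain ⟨u, hu, huR⟩ := hA κ
    obtain ⟨v, hv, hvR⟩ := hB κ
    refine ⟨u, hu, v, hv, hsub ?_⟩
    have h1 := h.source κ u hu
    have h2 := h.target κ v hv
    -- The levels of `u` and `v` differ by at least `M ≥ 2`, so the pair is neither a loop nor an
    -- arc.
    simp only [samplingShortcut, Finset.mem_filter, Finset.mem_univ, true_and]
    refine ⟨huR, hvR, ?_, h.reaches κ u hu v hv, fun ha => ?_⟩
    · rintro rfl
      omega
    · have := hl ha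
      omega

end Shortcut

/-! ### Transfer to hopsets -/

section Hopset

variable {V I : Type*}

theorem weightedDist_le {G : SimpleGraph V} {H : Finset (Sym2 V × ℝ≥0)} {k : ℕ} {l : ℝ≥0} {s t : V}
    (h : WeightedWalk G H k l s t) : weightedDist G H s t ≤ l :=
  iInf_le_of_le k <| iInf_le_of_le l <| iInf_le_of_le h le_rfl

/-- A single edge is a walk of `G ∪ H`, so preservation of distances forbids it to undercut the
distance in `G`. -/
theorem IsHopset.exists_walk_length_le {G : SimpleGraph V} {H : Finset (Sym2 V × ℝ≥0)} {D : ℕ}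
    (hH : IsHopset G D H) {s t : V} {w : ℝ≥0} (h : WeightedAdj G H s t w) :
    ∃ p : G.Walk s t, (p.length : ℝ≥0) ≤ w := by
  have h1 : (G.edist s t : ℝ≥0∞) ≤ w := by
    rw [← hH.dist_eq]
    simpa using weightedDist_le (.cons h (.nil t))
  have h2 : G.edist s t ≠ ⊤ := by
    intro h
    rw [h] at h1
    simp at h1
  obtain ⟨p, hp⟩ := SimpleGraph.exists_walk_of_edist_ne_top h2
  refine ⟨p, ?_⟩
  rw [← hp, ENat.toENNReal_coe] at h1
  exact_mod_cast h1

theorem mem_samplingHopset [Fintype V] {G : SimpleGraph V} {R : Set V} {u v : V} {w : ℝ≥0} :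
    (s(u, v), w) ∈ samplingHopset G R ↔
      u ∈ R ∧ v ∈ R ∧ u ≠ v ∧ G.Reachable u v ∧ ¬ G.Adj u v ∧ w = (G.dist u v : ℝ≥0) := by
  classical
  simp only [samplingHopset, Finset.mem_image, Finset.mem_filter, Finset.mem_univ, true_and,
    Prod.exists, Prod.mk.injEq, Sym2.eq_iff]
  constructor
  · rintro ⟨a, b, ⟨h1, h2, h3, h4, h5⟩, ⟨rfl, rfl⟩ | ⟨rfl, rfl⟩, rfl⟩
    · exact ⟨h1, h2, h3, h4, h5, rfl⟩
    · exact ⟨h2, h1, h3.symm, h4.symm, fun h => h5 h.symm, by rw [SimpleGraph.dist_comm]⟩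
  · rintro ⟨h1, h2, h3, h4, h5, rfl⟩
    exact ⟨u, v, ⟨h1, h2, h3, h4, h5⟩, Or.inl ⟨rfl, rfl⟩, rfl⟩

theorem weightedAdj_samplingHopset_univ [Fintype V] {G : SimpleGraph V} {u v : V} {w : ℝ≥0} :
    WeightedAdj G (samplingHopset G Set.univ) u v w ↔
      u ≠ v ∧ G.Reachable u v ∧ w = (G.dist u v : ℝ≥0) := by
  unfold WeightedAdj
  rw [mem_samplingHopset]
  constructor
  · rintro (⟨h, rfl⟩ | ⟨-, -, h1, h2, -, h3⟩)
    · exact ⟨h.ne, h.reachable, by rw [SimpleGraph.dist_eq_one_iff_adj.2 h, Nat.cast_one]⟩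
    · exact ⟨h1, h2, h3⟩
  · rintro ⟨h1, h2, h3⟩
    by_cases ha : G.Adj u v
    · exact Or.inl ⟨ha, by rw [h3, SimpleGraph.dist_eq_one_iff_adj.2 ha, Nat.cast_one]⟩
    · exact Or.inr ⟨trivial, trivial, h1, h2, ha, h3⟩

theorem exists_weightedWalk_samplingHopset_univ [Fintype V] {G : SimpleGraph V} {s t : V}
    (h : G.Reachable s t) :
    ∃ k ≤ 1, WeightedWalk G (samplingHopset G Set.univ) k (G.dist s t : ℝ≥0) s t := by
  by_cases hst : s = t
  · subst hst
    exact ⟨0, by omega, by simpa using WeightedWalk.nil s⟩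
  · refine ⟨1, le_rfl, ?_⟩
    have := WeightedWalk.cons (weightedAdj_samplingHopset_univ.2 ⟨hst, h, rfl⟩) (.nil t)
    rwa [add_zero] at this

theorem exists_walk_of_weightedWalk_samplingHopset_univ [Fintype V] {G : SimpleGraph V} {k : ℕ}
    {l : ℝ≥0} {s t : V} (h : WeightedWalk G (samplingHopset G Set.univ) k l s t) :
    ∃ p : G.Walk s t, (p.length : ℝ≥0) = l := by
  induction h with
  | nil s => exact ⟨.nil, by simp⟩
  | cons h _ ih =>
    obtain ⟨-, hr, rfl⟩ := weightedAdj_samplingHopset_univ.1 h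
    obtain ⟨p, hp⟩ := hr.exists_walk_length_eq_dist
    obtain ⟨q, rfl⟩ := ih
    exact ⟨p.append q, by rw [SimpleGraph.Walk.length_append, hp, Nat.cast_add]⟩

theorem isHopset_samplingHopset_univ [Fintype V] (G : SimpleGraph V) :
    IsHopset G 1 (samplingHopset G Set.univ) where
  additional := by
    intro e w h
    induction e with
    | _ u v =>
    obtain ⟨-, -, h1, h2, h3, -⟩ := mem_samplingHopset.1 h
    exact ⟨by simpa using h1, fun h => h3 (by simpa using h.1)⟩
  dist_eq := by
    intro s t
    apply le_antisymm
    · by_cases h : G.Reachable s t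
      · obtain ⟨k, -, hk⟩ := exists_weightedWalk_samplingHopset_univ h
        refine (weightedDist_le hk).trans (le_of_eq ?_)
        rw [← h.coe_dist_eq_edist]
        simp
      · rw [SimpleGraph.edist_eq_top_of_not_reachable h]
        simp
    · refine le_iInf fun k => le_iInf fun l => le_iInf fun h => ?_
      obtain ⟨p, rfl⟩ := exists_walk_of_weightedWalk_samplingHopset_univ h
      have := ENat.toENNReal_le.2 p.edist_le
      simpa using this
  diameter := fun _ _ h => exists_weightedWalk_samplingHopset_univ h

/-- The first edge of a shortest path is a certificate, because the rest of the path is again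
shortest. As for shortcuts, this keeps the infimum from being taken over the empty set. -/
theorem isCertifiedHopset_samplingHopset_univ [Fintype V] (G : SimpleGraph V) :
    IsCertifiedHopset G (samplingHopset G Set.univ) where
  hopset := ⟨1, isHopset_samplingHopset_univ G⟩
  certified := by
    intro u v w h
    obtain ⟨-, -, hne, hr, ha, rfl⟩ := mem_samplingHopset.1 h
    obtain ⟨p, hp⟩ := hr.exists_walk_length_eq_dist
    cases p with
    | nil => exact absurd rfl hne
    | @cons _ x _ hux q =>
      have hq : q.length = G.dist x v := by
        refine le_antisymm ?_ (SimpleGraph.dist_le q)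
        obtain ⟨q', hq'⟩ := q.reachable.exists_walk_length_eq_dist
        have := SimpleGraph.dist_le (SimpleGraph.Walk.cons hux q')
        simp only [SimpleGraph.Walk.length_cons] at this hp
        omega
      refine ⟨x, 1, (G.dist x v : ℝ≥0), Or.inl ⟨hux, rfl⟩, weightedAdj_samplingHopset_univ.2
        ⟨?_, q.reachable, rfl⟩, ?_⟩
      · rintro rfl
        exact ha hux
      · rw [← hp, SimpleGraph.Walk.length_cons, hq]
        push_cast
        ring

/-! ### The undirected graph underlying a levelled digraph -/

variable {G : Digraph V} {lev : V → ℕ}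

theorem IsLevelling.fromRel_adj (hl : IsLevelling G lev) {x y : V} :
    (SimpleGraph.fromRel G.Adj).Adj x y ↔ G.Adj x y ∨ G.Adj y x := by
  rw [SimpleGraph.fromRel_adj, and_iff_right_iff_imp]
  rintro (h | h) rfl <;> · have := hl h; omega

theorem IsLevelling.le_add_length (hl : IsLevelling G lev) {x y : V}
    (p : (SimpleGraph.fromRel G.Adj).Walk x y) : lev y ≤ lev x + p.length := by
  induction p with
  | nil => simp
  | cons h p ih =>
    rw [SimpleGraph.Walk.length_cons]
    rcases hl.fromRel_adj.1 h with h | h <;> · have := hl h; omega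

/-- Every undirected step changes the level by exactly one, so a walk that gains its full length in
level only uses arcs forwards. -/
theorem IsLevelling.reaches_of_length (hl : IsLevelling G lev) {x y : V}
    (p : (SimpleGraph.fromRel G.Adj).Walk x y) (hp : lev y = lev x + p.length) :
    Reaches G x y := by
  induction p with
  | nil => exact .refl
  | cons h p ih =>
    rw [SimpleGraph.Walk.length_cons] at hp
    have h1 := hl.le_add_length p
    rcases hl.fromRel_adj.1 h with h | h
    · have := hl h
      exact .head h (ih (by omega))
    · have := hl h
      omega

theorem IsLevelling.exists_walk_length (hl : IsLevelling G lev) {x y : V} (h : Reaches G x y) :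
    ∃ p : (SimpleGraph.fromRel G.Adj).Walk x y, lev y = lev x + p.length := by
  induction h using Relation.ReflTransGen.head_induction_on with
  | refl => exact ⟨.nil, by simp⟩
  | head h _ ih =>
    obtain ⟨p, hp⟩ := ih
    refine ⟨.cons (hl.fromRel_adj.2 (Or.inl h)) p, ?_⟩
    have := hl h
    rw [SimpleGraph.Walk.length_cons]
    omega

theorem IsLevelling.dist_eq (hl : IsLevelling G lev) {x y : V} (h : Reaches G x y) :
    (SimpleGraph.fromRel G.Adj).dist x y = lev y - lev x := by
  obtain ⟨p, hp⟩ := hl.exists_walk_length h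
  obtain ⟨q, hq⟩ := p.reachable.exists_walk_length_eq_dist
  have := SimpleGraph.dist_le p
  have := hl.le_add_length q
  omega

theorem IsLevelling.numArcs_eq (hl : IsLevelling G lev) :
    numArcs G = (SimpleGraph.fromRel G.Adj).edgeSet.ncard := by
  have himg : (SimpleGraph.fromRel G.Adj).edgeSet =
      (fun q : V × V => s(q.1, q.2)) '' {q : V × V | G.Adj q.1 q.2} := by
    ext e
    induction e with
    | _ u v =>
    simp only [SimpleGraph.mem_edgeSet, Set.mem_image, Set.mem_ofPred_eq, Prod.exists, Sym2.eq_iff]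
    rw [hl.fromRel_adj]
    constructor
    · rintro (h | h)
      · exact ⟨u, v, h, Or.inl ⟨rfl, rfl⟩⟩
      · exact ⟨v, u, h, Or.inr ⟨rfl, rfl⟩⟩
    · rintro ⟨a, b, h, ⟨rfl, rfl⟩ | ⟨rfl, rfl⟩⟩
      · exact Or.inl h
      · exact Or.inr h
  rw [himg, Set.InjOn.ncard_image]
  · rfl
  · rintro ⟨a, b⟩ h ⟨c, d⟩ h' heq
    have h1 := hl h
    have h2 := hl h'
    rcases Sym2.eq_iff.1 heq with ⟨e, e'⟩ | ⟨e, e'⟩ <;> dsimp only at e e' h1 h2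
    · rw [e, e']
    · subst e e'
      omega

open Classical in
/-- The pairs joined by a path of `G` that are edges of `H` of weight their level difference. -/
noncomputable def monotonePairs [Fintype V] (G : Digraph V) (lev : V → ℕ)
    (H : Finset (Sym2 V × ℝ≥0)) : Finset (V × V) :=
  {q : V × V | Reaches G q.1 q.2 ∧ q.1 ≠ q.2 ∧ (s(q.1, q.2), ((lev q.2 - lev q.1 : ℕ) : ℝ≥0)) ∈ H}

/-- The orientation of a monotone pair is recovered from its unordered edge, since levels strictly
increase along it. -/
theorem IsLevelling.card_monotonePairs_le [Fintype V] (hl : IsLevelling G lev)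
    (H : Finset (Sym2 V × ℝ≥0)) : (monotonePairs G lev H).card ≤ H.card := by
  refine Finset.card_le_card_of_injOn
    (fun q => (s(q.1, q.2), ((lev q.2 - lev q.1 : ℕ) : ℝ≥0))) (fun q hq => ?_) ?_
  · simp only [monotonePairs, Finset.coe_filter, Finset.mem_univ, true_and] at hq
    exact hq.2.2
  · rintro ⟨a, b⟩ h ⟨c, d⟩ h' heq
    simp only [monotonePairs, Finset.coe_filter, Finset.mem_univ, true_and,
      Set.mem_ofPred_eq] at h h'
    have h1 := hl.lt_of_reaches h.1 h.2.1
    have h2 := hl.lt_of_reaches h'.1 h'.2.1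
    rcases Sym2.eq_iff.1 (congrArg Prod.fst heq) with ⟨e, e'⟩ | ⟨e, e'⟩ <;> dsimp only at e e'
    · rw [e, e']
    · subst e e'
      omega

theorem IsLevelling.level_le_add_weight (hl : IsLevelling G lev) {H : Finset (Sym2 V × ℝ≥0)}
    {D : ℕ} (hH : IsHopset (SimpleGraph.fromRel G.Adj) D H) {x y : V} {w : ℝ≥0}
    (h : WeightedAdj (SimpleGraph.fromRel G.Adj) H x y w) : (lev y : ℝ) ≤ lev x + w := by
  obtain ⟨p, hp⟩ := hH.exists_walk_length_le h
  have h1 : (lev y : ℝ) ≤ lev x + p.length := by exact_mod_cast hl.le_add_length p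
  have h2 : (p.length : ℝ) ≤ w := by exact_mod_cast hp
  linarith

/-- The walk beneath the edge has length at most `w` and at least the level gain, which is `w`.
Equality makes the walk monotone and the weight an integer. -/
theorem IsLevelling.adj_or_mem_monotonePairs [Fintype V] (hl : IsLevelling G lev)
    {H : Finset (Sym2 V × ℝ≥0)} {D : ℕ} (hH : IsHopset (SimpleGraph.fromRel G.Adj) D H) {x y : V}
    {w : ℝ≥0} (h : WeightedAdj (SimpleGraph.fromRel G.Adj) H x y w)
    (hw : (lev y : ℝ) = lev x + w) : G.Adj x y ∨ (x, y) ∈ monotonePairs G lev H := by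
  obtain ⟨p, hp⟩ := hH.exists_walk_length_le h
  have h2 : (p.length : ℝ) ≤ w := by exact_mod_cast hp
  have h3 : lev y = lev x + p.length := by
    refine le_antisymm (hl.le_add_length p) ?_
    have : (lev x : ℝ) + p.length ≤ lev y := by linarith
    exact_mod_cast this
  have hr := hl.reaches_of_length p h3
  have hw' : w = ((lev y - lev x : ℕ) : ℝ≥0) := by
    rw [h3] at hw ⊢
    rw [Nat.add_sub_cancel_left]
    apply NNReal.coe_injective
    push_cast at hw ⊢
    linarith
  rcases h with ⟨ha, -⟩ | h
  · rcases hl.fromRel_adj.1 ha with ha | ha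
    · exact Or.inl ha
    · have := hl ha
      omega
  · right
    have hne : x ≠ y := by simpa using (hH.additional _ _ h).1
    simp only [monotonePairs, Finset.mem_filter, Finset.mem_univ, true_and]
    exact ⟨hr, hne, hw' ▸ h⟩

/-- Tightness passes to certificates: neither half gains more level than its weight, and both totals
agree, so both halves are tight. Hence the monotone pairs of a certified hopset form a certified set
of pairs. -/
theorem IsRigidSystem.le_hopsetCertComplexity [Fintype V] [Fintype I] {A B : I → Set V}
    {lo M : ℕ} (h : IsRigidSystem G lev A B lo M) (hM : 2 ≤ M) {R : Set V}
    (hA : ∀ κ, ∃ u ∈ A κ, u ∈ R) (hB : ∀ κ, ∃ v ∈ B κ, v ∈ R) :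
    Fintype.card I * (M - 1) ≤ hopsetCertComplexity (SimpleGraph.fromRel G.Adj)
      (samplingHopset (SimpleGraph.fromRel G.Adj) R) := by
  have hl := h.levelling
  refine le_csInf ⟨_, _, fun q hq => ?_, isCertifiedHopset_samplingHopset_univ _, rfl⟩ ?_
  · obtain ⟨e, w⟩ := q
    induction e with
    | _ u v =>
    rw [mem_samplingHopset] at hq ⊢
    exact ⟨trivial, trivial, hq.2.2⟩
  rintro _ ⟨H, hsub, ⟨⟨D, hD⟩, hcert⟩, rfl⟩
  refine le_trans (h.card_mul_le (T := monotonePairs G lev H) ⟨?_, ?_, ?_⟩ fun κ => ?_)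
    (hl.card_monotonePairs_le H)
  · intro q hq
    simp only [monotonePairs, Finset.mem_filter] at hq
    exact hq.2.1
  · intro q hq
    simp only [monotonePairs, Finset.mem_filter] at hq
    exact hq.2.2.1
  · rintro ⟨x, y⟩ hq
    simp only [monotonePairs, Finset.mem_filter, Finset.mem_univ, true_and] at hq
    obtain ⟨z, w₁, w₂, h1, h2, hw⟩ := hcert _ _ _ hq.2.2
    have hw' : ((lev y - lev x : ℕ) : ℝ) = w₁ + w₂ := by
      rw [← NNReal.coe_add, ← hw, NNReal.coe_natCast]
    rw [Nat.cast_sub (hl.le_of_reaches hq.1)] at hw'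
    have e1 := hl.level_le_add_weight hD h1
    have e2 := hl.level_le_add_weight hD h2
    exact ⟨z, hl.adj_or_mem_monotonePairs hD h1 (by linarith),
      hl.adj_or_mem_monotonePairs hD h2 (by linarith)⟩
  · obtain ⟨u, hu, huR⟩ := hA κ
    obtain ⟨v, hv, hvR⟩ := hB κ
    refine ⟨u, hu, v, hv, ?_⟩
    have h1 := h.source κ u hu
    have h2 := h.target κ v hv
    have hr := h.reaches κ u hu v hv
    have hne : u ≠ v := by
      rintro rfl
      omega
    simp only [monotonePairs, Finset.mem_filter, Finset.mem_univ, true_and]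
    refine ⟨hr, hne, hsub (mem_samplingHopset.2 ⟨huR, hvR, hne, ?_, fun ha => ?_, ?_⟩)⟩
    · exact (hl.exists_walk_length hr).choose.reachable
    · rcases hl.fromRel_adj.1 ha with ha | ha <;> · have := hl ha; omega
    · rw [hl.dist_eq hr]

end Hopset

/-! ### Probability that the sample hits every tail -/

section Sampling

open MeasureTheory

theorem setBernoulli_univ_disjoint {V : Type*} (p : unitInterval) (U : Finset V) :
    (ProbabilityTheory.setBernoulli (Set.univ : Set V) p).real {R | ∀ i ∈ U, i ∉ R} =
      (1 - p : ℝ) ^ U.card := by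
  -- Missing `U` is a cylinder event over finitely many coordinates, so its product measure
  -- factorizes.
  have hset : ((fun q : V → Prop => {i | q i}) ⁻¹' {R | ∀ i ∈ U, i ∉ R}) =
      Set.pi (U : Set V) fun _ => {False} := by
    ext q
    simp [Set.mem_pi]
  rw [measureReal_def, ProbabilityTheory.setBernoulli_apply', hset,
    Measure.infinitePi_pi _ (fun _ _ => .of_discrete)]
  simp

/-- If each of at most `N` sets of at least `τ` vertices is missed with probability at most
`(1 - p) ^ τ`, then all of them are hit except with probability `N * (1 - p) ^ τ`. -/
theorem one_sub_le_setBernoulli_hit {V J : Type*} [Fintype J] (p : unitInterval)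
    (U : J → Finset V) {τ : ℕ} (hU : ∀ j, τ ≤ (U j).card) {E : Set (Set V)}
    (hE : ∀ R : Set V, (∀ j, ∃ i ∈ U j, i ∈ R) → R ∈ E) :
    1 - Fintype.card J * (1 - p : ℝ) ^ τ ≤
      (ProbabilityTheory.setBernoulli (Set.univ : Set V) p).real E := by
  set μ := ProbabilityTheory.setBernoulli (Set.univ : Set V) p
  have hcover : (Set.univ : Set (Set V)) ⊆
      E ∪ ⋃ j ∈ (Finset.univ : Finset J), {R | ∀ i ∈ U j, i ∉ R} := by
    intro R _
    by_cases h : ∀ j, ∃ i ∈ U j, i ∈ R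
    · exact Or.inl (hE R h)
    · push Not at h
      right
      simpa using h
  have h1 : (1 : ℝ) ≤ μ.real E + ∑ j : J, μ.real {R | ∀ i ∈ U j, i ∉ R} := by
    calc (1 : ℝ) = μ.real Set.univ := by simp [μ]
      _ ≤ μ.real (E ∪ ⋃ j ∈ (Finset.univ : Finset J), {R | ∀ i ∈ U j, i ∉ R}) :=
          measureReal_mono hcover
      _ ≤ _ := (measureReal_union_le _ _).trans
          (add_le_add_right (measureReal_biUnion_finset_le _ _) _)
  have h2 : ∑ j : J, μ.real {R | ∀ i ∈ U j, i ∉ R} ≤ ∑ _j : J, (1 - p : ℝ) ^ τ := by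
    refine Finset.sum_le_sum fun j _ => ?_
    rw [setBernoulli_univ_disjoint]
    exact pow_le_pow_of_le_one (by linarith [p.2.2]) (by linarith [p.2.1]) (hU j)
  simp only [Finset.sum_const, Finset.card_univ, nsmul_eq_mul] at h2
  linarith

end Sampling

/-! ### Embedding a rigid system into a larger vertex set -/

section Map

variable {V W I : Type*} {G : Digraph V} {lev : V → ℕ}

/-- The image of a digraph under a map of the vertices. -/
def mapDigraph (G : Digraph V) (f : V → W) : Digraph W := ⟨Relation.Map G.Adj f f⟩

theorem Reaches.map {x y : V} (h : Reaches G x y) (f : V → W) :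
    Reaches (mapDigraph G f) (f x) (f y) :=
  Relation.ReflTransGen.lift f (fun a b h => ⟨a, b, h, rfl, rfl⟩) _ _ h

theorem reaches_of_mapDigraph {f : V → W} (hf : f.Injective) {x y : V}
    (h : Reaches (mapDigraph G f) (f x) (f y)) : Reaches G x y := by
  have key : ∀ {z : W}, Reaches (mapDigraph G f) (f x) z → ∃ b, f b = z ∧ Reaches G x b := by
    intro z h
    induction h with
    | refl => exact ⟨x, rfl, .refl⟩
    | tail _ h ih =>
      obtain ⟨b, rfl, hb⟩ := ih
      obtain ⟨a, c, hac, ha, rfl⟩ := h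
      rw [hf ha] at hac
      exact ⟨c, rfl, hb.tail hac⟩
  obtain ⟨b, hb, h⟩ := key h
  rwa [hf hb] at h

/-- Vertices outside the range of `f` are isolated, so their default level 0 is harmless. -/
theorem IsRigidSystem.map {A B : I → Set V} {lo M : ℕ} (h : IsRigidSystem G lev A B lo M)
    {f : V → W} (hf : f.Injective) :
    IsRigidSystem (mapDigraph G f) (Function.extend f lev 0) (fun κ => f '' A κ)
      (fun κ => f '' B κ) lo M where
  levelling := by
    rintro _ _ ⟨a, b, hab, rfl, rfl⟩
    rw [hf.extend_apply, hf.extend_apply]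
    exact h.levelling hab
  source := by
    rintro κ _ ⟨u, hu, rfl⟩
    rw [hf.extend_apply]
    exact h.source κ u hu
  target := by
    rintro κ _ ⟨u, hu, rfl⟩
    rw [hf.extend_apply]
    exact h.target κ u hu
  reaches := by
    rintro κ _ ⟨u, hu, rfl⟩ _ ⟨v, hv, rfl⟩
    exact (h.reaches κ u hu v hv).map f
  separated := by
    rintro κ κ' _ _ _ ⟨w₀, w₁, h1, rfl, rfl⟩ ⟨w₁', w₂, h2, h3, rfl⟩ hlo hhi
      ⟨_, ⟨u, hu, rfl⟩, _, ⟨v, hv, rfl⟩, r1, r2⟩ ⟨_, ⟨u', hu', rfl⟩, _, ⟨v', hv', rfl⟩, r3, r4⟩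
    rw [hf h3] at h2
    rw [hf.extend_apply] at hlo hhi
    exact h.separated κ κ' w₀ w₁ w₂ h1 h2 hlo hhi
      ⟨u, hu, v, hv, reaches_of_mapDigraph hf r1, reaches_of_mapDigraph hf r2⟩
      ⟨u', hu', v', hv', reaches_of_mapDigraph hf r3, reaches_of_mapDigraph hf r4⟩

theorem numArcs_mapDigraph {f : V → W} (hf : f.Injective) :
    numArcs (mapDigraph G f) = numArcs G := by
  have : {q : W × W | (mapDigraph G f).Adj q.1 q.2} =
      Prod.map f f '' {q : V × V | G.Adj q.1 q.2} := by
    ext ⟨x, y⟩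
    simp only [mapDigraph, Relation.Map, Set.mem_ofPred_eq, Set.mem_image, Prod.exists,
      Prod.map_apply, Prod.mk.injEq]
  rw [numArcs, this, Set.ncard_image_of_injective _ (hf.prodMap hf), numArcs]

end Map

/-! ### Uniqueness of paths with two alternating slopes -/

section Convexity

/-- The finite abelian group in which the core of the construction lives. -/
abbrev CoreGroup (L J : ℕ) : Type := ZMod (L * J) × ZMod (L * J) × ZMod (2 * L * J ^ 2)

/-- The displacement of slope `j` at layer `i`: the slope is recorded linearly in a coordinate that
depends on the parity of `i`, and quadratically in the last coordinate. -/
def displacement (L J i j : ℕ) : CoreGroup L J :=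
  if Even i then (j, 0, (j ^ 2 : ℕ)) else (0, j, (j ^ 2 : ℕ))

theorem sum_range_two_mul {M : Type*} [AddCommMonoid M] (f : ℕ → M) (L : ℕ) :
    ∑ k ∈ Finset.range (2 * L), f k = ∑ m ∈ Finset.range L, (f (2 * m) + f (2 * m + 1)) := by
  induction L with
  | zero => simp
  | succ L ih =>
    rw [Finset.sum_range_succ, ← ih, mul_add, mul_one, Finset.sum_range_succ,
      Finset.sum_range_succ, add_assoc]

theorem sum_displacement (L J : ℕ) (f : ℕ → ℕ) :
    ∑ k ∈ Finset.range (2 * L), displacement L J k (f k) =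
      (((∑ m ∈ Finset.range L, f (2 * m) : ℕ) : ZMod (L * J)),
        ((∑ m ∈ Finset.range L, f (2 * m + 1) : ℕ) : ZMod (L * J)),
        ((∑ m ∈ Finset.range L, (f (2 * m) ^ 2 + f (2 * m + 1) ^ 2) : ℕ) :
          ZMod (2 * L * J ^ 2))) := by
  rw [sum_range_two_mul]
  have h1 : ∀ m, Even (2 * m) := fun m => even_two_mul m
  have h2 : ∀ m, ¬ Even (2 * m + 1) := fun m => by simp
  simp only [displacement, h1, h2, if_true, if_false, Prod.mk_add_mk, add_zero, zero_add]
  refine Prod.ext ?_ (Prod.ext ?_ ?_) <;>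
    simp [Prod.fst_sum, Prod.snd_sum]

theorem natCast_injOn_zmod {m a b : ℕ} (ha : a < m) (hb : b < m)
    (h : (a : ZMod m) = (b : ZMod m)) : a = b := by
  rw [ZMod.natCast_eq_natCast_iff'] at h
  rwa [Nat.mod_eq_of_lt ha, Nat.mod_eq_of_lt hb] at h

theorem sum_range_lt {f : ℕ → ℕ} {L b : ℕ} (hL : 0 < L) (hf : ∀ m < L, f m < b) :
    ∑ m ∈ Finset.range L, f m < L * b := by
  have := Finset.sum_lt_sum_of_nonempty (s := Finset.range L) (g := fun _ => b)
    (by simpa using hL.ne') (fun m hm => hf m (Finset.mem_range.1 hm))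
  simpa using this

/-- The moduli exceed every sum that can occur, so equality in the group is equality of integers.
The slopes then have prescribed means on even and on odd layers, and a sum of squares as small as
these means allow, so they are constant on each parity. -/
theorem two_alternating_slopes_rigid {L J θ₀ θ₁ : ℕ} {f : ℕ → ℕ} (hf : ∀ k < 2 * L, f k < J)
    (h₀ : θ₀ < J) (h₁ : θ₁ < J)
    (h : ∑ k ∈ Finset.range (2 * L), displacement L J k (f k) =
      ∑ k ∈ Finset.range (2 * L), displacement L J k (if Even k then θ₀ else θ₁)) :
    ∀ k < 2 * L, f k = if Even k then θ₀ else θ₁ := by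
  rcases Nat.eq_zero_or_pos L with rfl | hL
  · simp
  have h1 : ∀ m, Even (2 * m) := fun m => even_two_mul m
  have h2 : ∀ m, ¬ Even (2 * m + 1) := fun m => by simp
  rw [sum_displacement, sum_displacement, Prod.mk.injEq, Prod.mk.injEq] at h
  simp only [h1, h2, if_true, if_false] at h
  obtain ⟨e0, e1, e2⟩ := h
  have sq_lt : ∀ {a b : ℕ}, a < J → b < J → a ^ 2 + b ^ 2 < 2 * J ^ 2 := by
    intro a b ha hb
    nlinarith
  have e0 := natCast_injOn_zmod (sum_range_lt hL fun m hm => hf _ (by omega))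
    (sum_range_lt hL fun m _ => h₀) e0
  have e1 := natCast_injOn_zmod (sum_range_lt hL fun m hm => hf _ (by omega))
    (sum_range_lt hL fun m _ => h₁) e1
  have e2 := natCast_injOn_zmod
    (by
      have := sum_range_lt (b := 2 * J ^ 2) hL fun m hm =>
        sq_lt (hf (2 * m) (by omega)) (hf (2 * m + 1) (by omega))
      linarith)
    (by
      have := sum_range_lt (b := 2 * J ^ 2) hL fun m _ => sq_lt h₀ h₁
      linarith) e2
  -- The total squared deviation expands into the three prescribed sums and cancels.
  have hz : ∑ m ∈ Finset.range L,
      (((f (2 * m) : ℤ) - θ₀) ^ 2 + ((f (2 * m + 1) : ℤ) - θ₁) ^ 2) = 0 := by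
    have e0' : ∑ m ∈ Finset.range L, (f (2 * m) : ℤ) = ∑ _m ∈ Finset.range L, (θ₀ : ℤ) := by
      exact_mod_cast e0
    have e1' : ∑ m ∈ Finset.range L, (f (2 * m + 1) : ℤ) = ∑ _m ∈ Finset.range L, (θ₁ : ℤ) := by
      exact_mod_cast e1
    have e2' : ∑ m ∈ Finset.range L, ((f (2 * m) : ℤ) ^ 2 + (f (2 * m + 1) : ℤ) ^ 2) =
        ∑ _m ∈ Finset.range L, ((θ₀ : ℤ) ^ 2 + (θ₁ : ℤ) ^ 2) := by
      exact_mod_cast e2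
    have : ∀ m, ((f (2 * m) : ℤ) - θ₀) ^ 2 + ((f (2 * m + 1) : ℤ) - θ₁) ^ 2 =
        ((f (2 * m) : ℤ) ^ 2 + (f (2 * m + 1) : ℤ) ^ 2) - 2 * θ₀ * f (2 * m) -
          2 * θ₁ * f (2 * m + 1) + (θ₀ ^ 2 + θ₁ ^ 2) := fun m => by ring
    simp only [this]
    rw [Finset.sum_add_distrib, Finset.sum_sub_distrib, Finset.sum_sub_distrib, e2',
      ← Finset.mul_sum, ← Finset.mul_sum, e0', e1']
    simp only [Finset.sum_const, Finset.card_range, nsmul_eq_mul]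
    ring
  rw [Finset.sum_eq_zero_iff_of_nonneg fun m _ => by positivity] at hz
  intro k hk
  have hm := hz (k / 2) (Finset.mem_range.2 (by omega))
  have s0 := sq_nonneg ((f (2 * (k / 2)) : ℤ) - θ₀)
  have s1 := sq_nonneg ((f (2 * (k / 2) + 1) : ℤ) - θ₁)
  rcases Nat.even_or_odd' k with ⟨c, rfl | rfl⟩
  · have hc : 2 * c / 2 = c := by omega
    rw [hc] at hm s0 s1
    have : ((f (2 * c) : ℤ) - θ₀) ^ 2 = 0 := by linarith
    rw [if_pos (h1 c)]
    have := pow_eq_zero_iff (two_ne_zero) |>.1 this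
    omega
  · have hc : (2 * c + 1) / 2 = c := by omega
    rw [hc] at hm s0 s1
    have : ((f (2 * c + 1) : ℤ) - θ₁) ^ 2 = 0 := by linarith
    rw [if_neg (h2 c)]
    have := pow_eq_zero_iff (two_ne_zero) |>.1 this
    omega

theorem displacement_injOn {L J i j j' : ℕ} (hL : 0 < L) (hj : j < J) (hj' : j' < J)
    (h : displacement L J i j = displacement L J i j') : j = j' := by
  have hLJ : J ≤ L * J := Nat.le_mul_of_pos_left J hL
  unfold displacement at h
  split_ifs at h
  · exact natCast_injOn_zmod (by omega) (by omega) (congrArg Prod.fst h)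
  · exact natCast_injOn_zmod (by omega) (by omega) (congrArg (fun q => q.2.1) h)

end Convexity

/-! ### The gadget and its rigidity -/

section Gadget

/-- The parameters of the construction: the core of index `c` is entered from the tail `c + a` and
left to the tail `c + 2 * a`, for each `a` in a set without three-term progressions; `port a` is the
copy of the core layers, the starting point, and the pair of slopes used by `a`. -/
structure Gadget where
  N : ℕ
  τ : ℕ
  L : ℕ
  J : ℕ
  γ : ℕ
  q : ℕ
  A : Finset ℕ
  τ_pos : 0 < τ
  L_pos : 0 < L
  J_pos : 0 < J
  lt_of_mem : ∀ a ∈ A, a < N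
  free : ThreeAPFree (A : Set ℕ)
  port : A → Fin γ × CoreGroup L J × Fin J × Fin J
  port_injective : port.Injective

namespace Gadget

variable (P : Gadget)

/-- The `pad` vertices carry a complete bipartite graph, disjoint from the rest, whose only role is
to guarantee enough edges. -/
inductive Vertex
  | tailIn (s : Fin (2 * P.N)) (h : Fin P.τ)
  | tailOut (t : Fin (3 * P.N)) (h : Fin P.τ)
  | core (c : Fin P.N) (g : Fin P.γ) (i : Fin (2 * P.L + 1)) (x : CoreGroup P.L P.J)
  | pad (b : Bool) (k : Fin P.q)

variable {P}

/-- The slope used by `a` at layer `k`. -/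
def slope (a : P.A) (k : ℕ) : ℕ := if Even k then (P.port a).2.2.1 else (P.port a).2.2.2

/-- The position of the path of `a` at layer `i`. -/
def position (a : P.A) (i : ℕ) : CoreGroup P.L P.J :=
  (P.port a).2.1 + ∑ k ∈ Finset.range i, displacement P.L P.J k (slope a k)

variable (P) in
def digraph : Digraph P.Vertex where
  Adj
    | .tailIn s h, .tailIn s' h' => s = s' ∧ (h' : ℕ) = h + 1
    | .tailIn s h, .core c g i x => (h : ℕ) + 1 = P.τ ∧ (i : ℕ) = 0 ∧
        ∃ a : P.A, (s : ℕ) = c + a ∧ (P.port a).1 = g ∧ x = position a 0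
    | .core c g i x, .core c' g' i' x' => c = c' ∧ g = g' ∧ (i' : ℕ) = i + 1 ∧
        ∃ j : Fin P.J, x' = x + displacement P.L P.J i j
    | .core c g i x, .tailOut t h => (i : ℕ) = 2 * P.L ∧ (h : ℕ) = 0 ∧
        ∃ a : P.A, (t : ℕ) = c + 2 * a ∧ (P.port a).1 = g ∧ x = position a (2 * P.L)
    | .tailOut t h, .tailOut t' h' => t = t' ∧ (h' : ℕ) = h + 1
    | .pad b _, .pad b' _ => b = false ∧ b' = true
    | _, _ => False

def level : P.Vertex → ℕ
  | .tailIn _ h => h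
  | .core _ _ i _ => P.τ + i
  | .tailOut _ h => P.τ + (2 * P.L + 1) + h
  | .pad b _ => b.toNat

theorem level_tailOut (t : Fin (3 * P.N)) (h : Fin P.τ) :
    level (.tailOut t h) = P.τ + (2 * P.L + 1) + h := rfl

theorem isLevelling : IsLevelling P.digraph level := by
  rintro (⟨s, h⟩ | ⟨s, h⟩ | ⟨c, g, i, x⟩ | ⟨b, k⟩)
    (⟨s', h'⟩ | ⟨s', h'⟩ | ⟨c', g', i', x'⟩ | ⟨b', k'⟩) h <;>
    simp only [digraph] at h <;> simp only [level]
  · omega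
  · omega
  · omega
  · omega
  · omega
  · simp [h.1, h.2]

/-- What is known about a vertex reached from the tail `s`. -/
def Forward (s : Fin (2 * P.N)) : P.Vertex → Prop
  | .tailIn s' _ => s' = s
  | .core c g i x => ∃ a : P.A, ∃ f : ℕ → ℕ, (∀ k < (i : ℕ), f k < P.J) ∧ (s : ℕ) = c + a ∧
      (P.port a).1 = g ∧
      x = (P.port a).2.1 + ∑ k ∈ Finset.range i, displacement P.L P.J k (f k)
  | .tailOut _ _ => True
  | .pad _ _ => False

/-- What is known about a vertex that reaches the tail `t`. -/
def Backward (t : Fin (3 * P.N)) : P.Vertex → Prop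
  | .tailOut t' _ => t' = t
  | .core c g i x => ∃ a : P.A, ∃ f : ℕ → ℕ, (∀ k < 2 * P.L, (i : ℕ) ≤ k → f k < P.J) ∧
      (t : ℕ) = c + 2 * a ∧ (P.port a).1 = g ∧
      x + ∑ k ∈ Finset.Ico (i : ℕ) (2 * P.L), displacement P.L P.J k (f k) = position a (2 * P.L)
  | .tailIn _ _ => True
  | .pad _ _ => False

theorem forward_of_reaches {s : Fin (2 * P.N)} {h : Fin P.τ} {w : P.Vertex}
    (hw : Reaches P.digraph (.tailIn s h) w) : Forward s w := by
  induction hw with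
  | refl => rfl
  | @tail w w' _ hww' ih =>
    revert ih hww'
    rcases w with ⟨s, h⟩ | ⟨s, h⟩ | ⟨c, g, i, x⟩ | ⟨b, k⟩ <;>
    rcases w' with ⟨s', h'⟩ | ⟨s', h'⟩ | ⟨c', g', i', x'⟩ | ⟨b', k'⟩ <;>
    simp only [digraph, Forward, false_imp_iff, imp_true_iff, forall_const]
    · rintro ⟨rfl, -⟩ h
      exact h
    · rintro ⟨-, hi, a, hs, hg, rfl⟩ rfl
      -- No layer has been crossed yet, so the slope function is arbitrary.
      refine ⟨a, fun _ => 0, by simp [hi], hs, hg, ?_⟩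
      simp [hi, position]
    · rintro ⟨rfl, rfl, hi, j, rfl⟩ ⟨a, f, hf, hs, hg, rfl⟩
      refine ⟨a, Function.update f i j, fun k hk => ?_, hs, hg, ?_⟩
      · by_cases hki : k = i
        · simp [hki]
        · rw [Function.update_of_ne hki]
          exact hf k (by omega)
      · rw [hi, Finset.sum_range_succ, Function.update_self, add_assoc]
        congr 2
        refine Finset.sum_congr rfl fun k hk => ?_
        rw [Function.update_of_ne (Finset.mem_range.1 hk).ne]

theorem backward_of_reaches {t : Fin (3 * P.N)} {h : Fin P.τ} {w : P.Vertex}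
    (hw : Reaches P.digraph w (.tailOut t h)) : Backward t w := by
  induction hw using Relation.ReflTransGen.head_induction_on with
  | refl => rfl
  | @head w w' hww' _ ih =>
    revert ih hww'
    rcases w with ⟨s, h⟩ | ⟨s, h⟩ | ⟨c, g, i, x⟩ | ⟨b, k⟩ <;>
    rcases w' with ⟨s', h'⟩ | ⟨s', h'⟩ | ⟨c', g', i', x'⟩ | ⟨b', k'⟩ <;>
    simp only [digraph, Backward, false_imp_iff, imp_true_iff, forall_const, imp_false,
      not_false_eq_true]
    · rintro ⟨rfl, -⟩ h
      exact h
    · rintro ⟨hi, -, a, hs, hg, rfl⟩ rfl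
      refine ⟨a, fun _ => 0, fun k _ _ => by omega, hs, hg, ?_⟩
      simp [hi]
    · rintro ⟨rfl, rfl, hi, j, rfl⟩ ⟨a, f, hf, hs, hg, hx⟩
      have hi2 : (i : ℕ) < 2 * P.L := by have := i'.2; omega
      refine ⟨a, Function.update f i j, fun k hk hk' => ?_, hs, hg, ?_⟩
      · by_cases hki : k = i
        · simp [hki]
        · rw [Function.update_of_ne hki]
          exact hf k hk (by omega)
      · rw [← hx, Finset.sum_eq_sum_Ico_succ_bot hi2, Function.update_self, add_assoc, hi]
        congr 2
        refine Finset.sum_congr rfl fun k hk => ?_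
        rw [Function.update_of_ne]
        have := (Finset.mem_Ico.1 hk).1
        omega

/-- A path between the tails of `(c, a)` might use another core, entering by `b` and leaving by
`b'`. Comparing the tail indices gives a + b = 2b', so freeness from progressions forces b = b' = a
and the same core. Within it the path is unique by convexity. -/
theorem position_of_reaches {c : Fin P.N} {a : P.A} {s : Fin (2 * P.N)} {t : Fin (3 * P.N)}
    (hs : (s : ℕ) = c + a) (ht : (t : ℕ) = c + 2 * a) {h h' : Fin P.τ} {c' : Fin P.N} {g : Fin P.γ}
    {i : Fin (2 * P.L + 1)} {x : CoreGroup P.L P.J}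
    (h1 : Reaches P.digraph (.tailIn s h) (.core c' g i x))
    (h2 : Reaches P.digraph (.core c' g i x) (.tailOut t h')) :
    c' = c ∧ g = (P.port a).1 ∧ x = position a i := by
  obtain ⟨b, f, hf, hb, hg, hx⟩ := forward_of_reaches h1
  obtain ⟨b', f', hf', hb', hg', hx'⟩ := backward_of_reaches h2
  have hab : (a : ℕ) = b' := P.free a.2 b'.2 b.2 (by omega)
  have hbb : (b : ℕ) = a := by omega
  obtain rfl : b = a := Subtype.ext hbb
  obtain rfl : b' = b := Subtype.ext hab.symm
  have hi : (i : ℕ) ≤ 2 * P.L := by have := i.2; omega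
  -- The slopes before layer `i` come from the forward path and the others from the backward path;
  -- together they describe a full crossing.
  have hrig := two_alternating_slopes_rigid (L := P.L) (J := P.J)
    (f := fun k => if k < (i : ℕ) then f k else f' k)
    (fun k hk => by
      split_ifs with hki
      · exact hf k hki
      · exact hf' k hk (by omega)) (P.port b').2.2.1.2 (P.port b').2.2.2.2 (by
      have e1 : ∑ k ∈ Finset.range (2 * P.L),
          displacement P.L P.J k (if k < (i : ℕ) then f k else f' k) =
          ∑ k ∈ Finset.range i, displacement P.L P.J k (f k) +
          ∑ k ∈ Finset.Ico (i : ℕ) (2 * P.L), displacement P.L P.J k (f' k) := by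
        rw [← Finset.sum_range_add_sum_Ico _ hi]
        congr 1
        · exact Finset.sum_congr rfl fun k hk => by rw [if_pos (Finset.mem_range.1 hk)]
        · exact Finset.sum_congr rfl fun k hk => by
            rw [if_neg (Finset.mem_Ico.1 hk).1.not_gt]
      rw [e1]
      rw [hx, position, add_assoc] at hx'
      exact add_left_cancel hx')
  refine ⟨Fin.ext (by omega), hg.symm, ?_⟩
  rw [hx, position]
  congr 1
  refine Finset.sum_congr rfl fun k hk => ?_
  have hk := Finset.mem_range.1 hk
  have := hrig k (by omega)
  rw [if_pos hk] at this
  rw [this, slope]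

/-- The tail from which the pair `(c, a)` starts. -/
def tailInIndex (κ : Fin P.N × P.A) : Fin (2 * P.N) :=
  ⟨κ.1 + κ.2, by have := P.lt_of_mem _ κ.2.2; omega⟩

/-- The tail in which the pair `(c, a)` ends. -/
def tailOutIndex (κ : Fin P.N × P.A) : Fin (3 * P.N) :=
  ⟨κ.1 + 2 * κ.2, by have := P.lt_of_mem _ κ.2.2; omega⟩

theorem slope_lt (a : P.A) (k : ℕ) : slope a k < P.J := by
  unfold slope
  split_ifs
  exacts [(P.port a).2.2.1.2, (P.port a).2.2.2.2]

theorem position_succ (a : P.A) (i : ℕ) :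
    position a (i + 1) = position a i + displacement P.L P.J i (slope a i) := by
  rw [position, position, Finset.sum_range_succ, add_assoc]

theorem reaches_tailIn (s : Fin (2 * P.N)) (h h' : Fin P.τ) (hh : h ≤ h') :
    Reaches P.digraph (.tailIn s h) (.tailIn s h') := by
  obtain ⟨m, hm⟩ := h'
  induction m with
  | zero =>
    obtain rfl : h = ⟨0, hm⟩ := Fin.ext (by have : (h : ℕ) ≤ 0 := hh; simpa using this)
    exact .refl
  | succ m ih =>
    rcases hh.eq_or_lt with rfl | hh
    · exact .refl
    · exact .tail (ih (by omega) (by have : (h : ℕ) < m + 1 := hh; exact Nat.le_of_lt_succ this))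
        ⟨rfl, rfl⟩

theorem reaches_tailOut (t : Fin (3 * P.N)) (h h' : Fin P.τ) (hh : h ≤ h') :
    Reaches P.digraph (.tailOut t h) (.tailOut t h') := by
  obtain ⟨m, hm⟩ := h'
  induction m with
  | zero =>
    obtain rfl : h = ⟨0, hm⟩ := Fin.ext (by have : (h : ℕ) ≤ 0 := hh; simpa using this)
    exact .refl
  | succ m ih =>
    rcases hh.eq_or_lt with rfl | hh
    · exact .refl
    · exact .tail (ih (by omega) (by have : (h : ℕ) < m + 1 := hh; exact Nat.le_of_lt_succ this))
        ⟨rfl, rfl⟩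

theorem reaches_core (c : Fin P.N) (a : P.A) (m : ℕ) (hm : m < 2 * P.L + 1) :
    Reaches P.digraph (.core c (P.port a).1 ⟨0, by omega⟩ (position a 0))
      (.core c (P.port a).1 ⟨m, hm⟩ (position a m)) := by
  induction m with
  | zero => exact .refl
  | succ m ih =>
    exact .tail (ih (by omega)) ⟨rfl, rfl, rfl, ⟨_, slope_lt a m⟩, position_succ a m⟩

theorem reaches_tails (κ : Fin P.N × P.A) (h h' : Fin P.τ) :
    Reaches P.digraph (.tailIn (tailInIndex κ) h) (.tailOut (tailOutIndex κ) h') := by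
  have hτ := P.τ_pos
  refine (reaches_tailIn _ h ⟨P.τ - 1, by omega⟩ (Nat.le_sub_one_of_lt h.2)).trans (.head ?_
    ((reaches_core κ.1 κ.2 (2 * P.L) (by omega)).trans (.head ?_
    (reaches_tailOut _ ⟨0, hτ⟩ h' (Nat.zero_le _)))))
  · exact ⟨Nat.sub_add_cancel hτ, rfl, κ.2, rfl, rfl, rfl⟩
  · exact ⟨rfl, rfl, κ.2, rfl, rfl, rfl⟩

/-- Two consecutive core layers have opposite parity, so their arcs reveal both slopes. Going back
from the known position yields the starting point, and with the copy `g` the whole port, which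
determines `a`; the core index is visible. -/
theorem isRigidSystem : IsRigidSystem P.digraph level
    (fun κ : Fin P.N × P.A => Set.range (Vertex.tailIn (tailInIndex κ)))
    (fun κ => Set.range (Vertex.tailOut (tailOutIndex κ))) P.τ (2 * P.L) where
  levelling := isLevelling
  source := by
    rintro κ _ ⟨h, rfl⟩
    exact h.2.le
  target := by
    rintro κ _ ⟨h, rfl⟩
    simp only [level]
    omega
  reaches := by
    rintro κ _ ⟨h, rfl⟩ _ ⟨h', rfl⟩
    exact reaches_tails κ h h'
  separated := by
    rintro ⟨c, a⟩ ⟨c', a'⟩ w₀ w₁ w₂ h1 h2 hlo hhi ⟨_, ⟨u, rfl⟩, _, ⟨v, rfl⟩, r1, r2⟩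
      ⟨_, ⟨u', rfl⟩, _, ⟨v', rfl⟩, r3, r4⟩
    have l1 := isLevelling h1
    have l2 := isLevelling h2
    have hf := forward_of_reaches r1
    -- Levels between `τ` and `τ + 2L` contain only core vertices, apart from possible padding,
    -- which is not reached from a tail.
    obtain ⟨d, g, i, x, rfl⟩ : ∃ d g i x, w₀ = .core d g i x := by
      rcases w₀ with ⟨s, h⟩ | ⟨s, h⟩ | ⟨c, g, i, x⟩ | ⟨b, k⟩
      · exact absurd hlo (Nat.not_le.2 h.2)
      · rw [level_tailOut] at *
        omega
      · exact ⟨_, _, _, _, rfl⟩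
      · exact hf.elim
    obtain ⟨i₁, j, rfl, hi₁⟩ : ∃ (i₁ : Fin (2 * P.L + 1)) (j : Fin P.J),
        w₁ = .core d g i₁ (x + displacement P.L P.J i j) ∧ (i₁ : ℕ) = i + 1 := by
      rcases w₁ with ⟨s, h⟩ | ⟨s, h⟩ | ⟨c, g, i, x⟩ | ⟨b, k⟩
      · exact h1.elim
      · rw [level_tailOut] at *
        omega
      · obtain ⟨rfl, rfl, h, j, rfl⟩ := h1
        exact ⟨_, j, rfl, h⟩
      · exact h1.elim
    obtain ⟨i₂, j₁, rfl, hi₂⟩ : ∃ (i₂ : Fin (2 * P.L + 1)) (j₁ : Fin P.J),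
        w₂ = .core d g i₂ (x + displacement P.L P.J i j + displacement P.L P.J i₁ j₁) ∧
          (i₂ : ℕ) = i₁ + 1 := by
      rcases w₂ with ⟨s, h⟩ | ⟨s, h⟩ | ⟨c, g, i, x⟩ | ⟨b, k⟩
      · exact h2.elim
      · rw [level_tailOut] at *
        omega
      · obtain ⟨rfl, rfl, h, j, rfl⟩ := h2
        exact ⟨_, j, rfl, h⟩
      · exact h2.elim
    -- All three vertices lie on the unique path of `a`, so the displacements between them are its
    -- own and give its slopes at layers `i` and `i + 1`.
    have key : ∀ {c : Fin P.N} {a : P.A} {u v : Fin P.τ},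
        Reaches P.digraph (.tailIn (tailInIndex (c, a)) u) (.core d g i x) →
        Reaches P.digraph (.core d g i₂ (x + displacement P.L P.J i j +
          displacement P.L P.J i₁ j₁)) (.tailOut (tailOutIndex (c, a)) v) →
        d = c ∧ g = (P.port a).1 ∧ x = position a i ∧ slope a i = j ∧ slope a (i + 1) = j₁ := by
      intro c a u v r1 r2
      obtain ⟨hd, hg, hx⟩ := position_of_reaches rfl rfl r1 (.head h1 (.head h2 r2))
      obtain ⟨-, -, hx₁⟩ := position_of_reaches rfl rfl (r1.tail h1) (.head h2 r2)
      obtain ⟨-, -, hx₂⟩ := position_of_reaches rfl rfl ((r1.tail h1).tail h2) r2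
      rw [hx₁, hi₂, position_succ] at hx₂
      rw [hi₁, position_succ, ← hx] at hx₁
      refine ⟨hd, hg, hx, ?_, ?_⟩
      · exact (displacement_injOn P.L_pos j.2 (slope_lt a _) (add_left_cancel hx₁)).symm
      · rw [← hi₁]
        exact (displacement_injOn P.L_pos j₁.2 (slope_lt a _) (add_left_cancel hx₂)).symm
    obtain ⟨hd, hg, hx, hj, hj₁⟩ := key r1 r2
    obtain ⟨hd', hg', hx', hj', hj₁'⟩ := key r3 r4
    have hport : (P.port a).2.2 = (P.port a').2.2 := by
      rw [← hj'] at hj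
      rw [← hj₁'] at hj₁
      unfold slope at hj hj₁
      rcases Nat.even_or_odd (i : ℕ) with hi | hi
      · have hi' : ¬ Even ((i : ℕ) + 1) := by simpa [Nat.even_add_one] using hi
        rw [if_pos hi, if_pos hi] at hj
        rw [if_neg hi', if_neg hi'] at hj₁
        exact Prod.ext (Fin.ext hj) (Fin.ext hj₁)
      · have hi' : Even ((i : ℕ) + 1) := hi.add_one
        rw [← Nat.not_even_iff_odd] at hi
        rw [if_neg hi, if_neg hi] at hj
        rw [if_pos hi', if_pos hi'] at hj₁
        exact Prod.ext (Fin.ext hj₁) (Fin.ext hj)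
    have hslope : slope a = slope a' := by
      funext k
      unfold slope
      rw [hport]
    have hstart : (P.port a).2.1 = (P.port a').2.1 := by
      rw [hx] at hx'
      unfold position at hx'
      rw [hslope] at hx'
      exact add_right_cancel hx'
    have ha : a = a' := P.port_injective (Prod.ext (hg.symm.trans hg') (Prod.ext hstart hport))
    rw [ha, ← hd, ← hd']

end Gadget

end Gadget

namespace Gadget

/-! ### Counting vertices and arcs of the gadget -/

section Counting

variable {P : Gadget}

instance : NeZero P.L := ⟨P.L_pos.ne'⟩

instance : NeZero P.J := ⟨P.J_pos.ne'⟩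

variable (P) in
/-- A bound for the number of vertices of the gadget. -/
def size : ℕ :=
  5 * P.N * P.τ + P.N * P.γ * (2 * P.L + 1) * (2 * P.L ^ 3 * P.J ^ 4) + 2 * P.q

variable (P) in
/-- A bound for the number of arcs of the gadget. -/
def arcBound : ℕ :=
  5 * P.N * P.τ + P.N * P.γ * (2 * P.L + 1) * (2 * P.L ^ 3 * P.J ^ 4) * P.J +
    2 * (P.N * P.A.card) + P.q ^ 2

def Vertex.toSum : P.Vertex → (Fin (2 * P.N) × Fin P.τ) ⊕ (Fin (3 * P.N) × Fin P.τ) ⊕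
    (Fin P.N × Fin P.γ × Fin (2 * P.L + 1) × CoreGroup P.L P.J) ⊕ (Bool × Fin P.q)
  | .tailIn s h => .inl (s, h)
  | .tailOut t h => .inr (.inl (t, h))
  | .core c g i x => .inr (.inr (.inl (c, g, i, x)))
  | .pad b k => .inr (.inr (.inr (b, k)))

theorem Vertex.toSum_injective : (Vertex.toSum (P := P)).Injective := by
  rintro (⟨s, h⟩ | ⟨s, h⟩ | ⟨c, g, i, x⟩ | ⟨b, k⟩)
    (⟨s', h'⟩ | ⟨s', h'⟩ | ⟨c', g', i', x'⟩ | ⟨b', k'⟩) <;>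
    simp [Vertex.toSum]

instance : Finite P.Vertex := Finite.of_injective _ Vertex.toSum_injective

theorem exists_vertex_injective {n : ℕ} (hn : P.size ≤ n) :
    ∃ f : P.Vertex → Fin n, f.Injective := by
  have hcard : Fintype.card ((Fin (2 * P.N) × Fin P.τ) ⊕ (Fin (3 * P.N) × Fin P.τ) ⊕
      (Fin P.N × Fin P.γ × Fin (2 * P.L + 1) × CoreGroup P.L P.J) ⊕ (Bool × Fin P.q)) ≤
      Fintype.card (Fin n) := by
    rw [Fintype.card_fin]
    refine le_trans (le_of_eq ?_) hn
    simp only [Fintype.card_sum, Fintype.card_prod, Fintype.card_fin, Fintype.card_bool, ZMod.card]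
    unfold size
    ring
  obtain ⟨e⟩ := Function.Embedding.nonempty_of_card_le hcard
  exact ⟨e ∘ Vertex.toSum, e.injective.comp Vertex.toSum_injective⟩

/-- The successor in `Fin n`, wrapping around. -/
def cyclicSucc {n : ℕ} (i : Fin n) : Fin n := ⟨(i + 1) % n, Nat.mod_lt _ i.pos⟩

theorem eq_cyclicSucc {n : ℕ} {i j : Fin n} (h : (j : ℕ) = i + 1) : j = cyclicSucc i := by
  apply Fin.ext
  change (j : ℕ) = (i + 1) % n
  rw [← h, Nat.mod_eq_of_lt j.2]

/-- A parametrization of pairs of vertices that covers all arcs. -/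
def arcCover : ((Fin (2 * P.N) × Fin P.τ) ⊕ (Fin (3 * P.N) × Fin P.τ)) ⊕
    (Fin P.N × Fin P.γ × Fin (2 * P.L + 1) × CoreGroup P.L P.J × Fin P.J) ⊕
    ((Fin P.N × P.A) ⊕ (Fin P.N × P.A)) ⊕ (Fin P.q × Fin P.q) → P.Vertex × P.Vertex
  | .inl (.inl (s, h)) => (.tailIn s h, .tailIn s (cyclicSucc h))
  | .inl (.inr (s, h)) => (.tailOut s h, .tailOut s (cyclicSucc h))
  | .inr (.inl (c, g, i, x, j)) =>
      (.core c g i x, .core c g (cyclicSucc i) (x + displacement P.L P.J i j))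
  | .inr (.inr (.inl (.inl κ))) =>
      (.tailIn (tailInIndex κ) ⟨P.τ - 1, Nat.sub_one_lt P.τ_pos.ne'⟩,
        .core κ.1 (P.port κ.2).1 0 (position κ.2 0))
  | .inr (.inr (.inl (.inr κ))) =>
      (.core κ.1 (P.port κ.2).1 (Fin.last _) (position κ.2 (2 * P.L)),
        .tailOut (tailOutIndex κ) ⟨0, P.τ_pos⟩)
  | .inr (.inr (.inr (k, k'))) => (.pad false k, .pad true k')

/-- Only an upper bound is needed, so the parametrization may also produce pairs that are not arcs,
such as those where the successor wraps around. -/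
theorem numArcs_le : numArcs P.digraph ≤ P.arcBound := by
  have hsub : {q : P.Vertex × P.Vertex | P.digraph.Adj q.1 q.2} ⊆ Set.range (arcCover (P := P)) := by
    rintro ⟨⟨s, h⟩ | ⟨s, h⟩ | ⟨c, g, i, x⟩ | ⟨b, k⟩,
      ⟨s', h'⟩ | ⟨s', h'⟩ | ⟨c', g', i', x'⟩ | ⟨b', k'⟩⟩ hq <;>
      simp only [digraph, Set.mem_ofPred_eq] at hq
    · obtain ⟨rfl, h⟩ := hq
      exact ⟨.inl (.inl (s, _)), by rw [eq_cyclicSucc h]; rfl⟩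
    · obtain ⟨h, hi, a, hs, rfl, rfl⟩ := hq
      refine ⟨.inr (.inr (.inl (.inl (c', a)))), ?_⟩
      obtain rfl : i' = 0 := Fin.ext hi
      obtain rfl : s = tailInIndex (c', a) := Fin.ext hs
      simp only [arcCover, Prod.mk.injEq, Vertex.tailIn.injEq, true_and, and_true]
      exact Fin.ext (by dsimp only; omega)
    · obtain ⟨rfl, h⟩ := hq
      exact ⟨.inl (.inr (s, _)), by rw [eq_cyclicSucc h]; rfl⟩
    · obtain ⟨hi, h, a, hs, rfl, rfl⟩ := hq
      refine ⟨.inr (.inr (.inl (.inr (c, a)))), ?_⟩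
      obtain rfl : i = Fin.last _ := Fin.ext hi
      obtain rfl : s' = tailOutIndex (c, a) := Fin.ext hs
      obtain rfl : h' = ⟨0, P.τ_pos⟩ := Fin.ext h
      rfl
    · obtain ⟨rfl, rfl, h, j, rfl⟩ := hq
      exact ⟨.inr (.inl (c, g, i, x, j)), by rw [eq_cyclicSucc h]; rfl⟩
    · obtain ⟨rfl, rfl⟩ := hq
      exact ⟨.inr (.inr (.inr (k, k'))), rfl⟩
  refine (Set.ncard_le_ncard hsub).trans ?_
  rw [← Set.image_univ]
  refine (Set.ncard_image_le).trans ?_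
  rw [Set.ncard_univ, Nat.card_eq_fintype_card]
  simp only [Fintype.card_sum, Fintype.card_prod, Fintype.card_fin, Fintype.card_coe, ZMod.card]
  unfold arcBound
  apply le_of_eq
  ring

theorem sq_le_numArcs : P.q ^ 2 ≤ numArcs P.digraph := by
  have hinj : (fun k : Fin P.q × Fin P.q =>
      ((Vertex.pad false k.1 : P.Vertex), (Vertex.pad true k.2 : P.Vertex))).Injective := by
    rintro ⟨a, b⟩ ⟨c, d⟩ h
    simpa using h
  have h := Set.ncard_image_of_injective Set.univ hinj
  rw [Set.ncard_univ, Nat.card_eq_fintype_card, Fintype.card_prod, Fintype.card_fin, ← sq] at h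
  rw [← h]
  refine Set.ncard_le_ncard ?_
  rintro _ ⟨⟨k, k'⟩, -, rfl⟩
  exact ⟨rfl, rfl⟩

variable (P) in
/-- In a graph that contains the gadget, sampling a vertex of every tail makes both certification
complexities large. -/
theorem exists_digraph {n : ℕ} (hn : P.size ≤ n) :
    ∃ (G : Digraph (Fin n)) (lev : Fin n → ℕ) (U : Fin (2 * P.N) ⊕ Fin (3 * P.N) → Finset (Fin n)),
      IsLevelling G lev ∧ P.q ^ 2 ≤ numArcs G ∧ numArcs G ≤ P.arcBound ∧ (∀ j, (U j).card = P.τ) ∧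
      ∀ R : Set (Fin n), (∀ j, ∃ i ∈ U j, i ∈ R) →
        P.N * P.A.card * (2 * P.L - 1) ≤ shortcutCertComplexity G (samplingShortcut G R) ∧
        P.N * P.A.card * (2 * P.L - 1) ≤ hopsetCertComplexity (SimpleGraph.fromRel G.Adj)
          (samplingHopset (SimpleGraph.fromRel G.Adj) R) := by
  obtain ⟨f, hf⟩ := exists_vertex_injective hn
  have hrig := (isRigidSystem (P := P)).map hf
  have hin : ∀ s, (fun h => f (.tailIn s h)).Injective := fun s a b h => by simpa using hf h
  have hout : ∀ t, (fun h => f (.tailOut t h)).Injective := fun s a b h => by simpa using hf h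
  have hM : 2 ≤ 2 * P.L := by have := P.L_pos; omega
  have hI : Fintype.card (Fin P.N × P.A) = P.N * P.A.card := by simp
  refine ⟨mapDigraph P.digraph f, Function.extend f level 0,
    Sum.elim (fun s => Finset.univ.map ⟨_, hin s⟩) (fun t => Finset.univ.map ⟨_, hout t⟩),
    hrig.levelling, ?_, ?_, ?_, fun R hR => ?_⟩
  · rw [numArcs_mapDigraph hf]
    exact sq_le_numArcs
  · rw [numArcs_mapDigraph hf]
    exact numArcs_le
  · rintro (s | t) <;> simp
  · have hA : ∀ κ : Fin P.N × P.A,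
        ∃ u ∈ f '' Set.range (Vertex.tailIn (tailInIndex κ)), u ∈ R := by
      intro κ
      obtain ⟨i, hi, hiR⟩ := hR (.inl (tailInIndex κ))
      simp only [Sum.elim_inl, Finset.mem_map, Finset.mem_univ, true_and] at hi
      obtain ⟨h, rfl⟩ := hi
      exact ⟨_, ⟨_, ⟨h, rfl⟩, rfl⟩, hiR⟩
    have hB : ∀ κ : Fin P.N × P.A,
        ∃ v ∈ f '' Set.range (Vertex.tailOut (tailOutIndex κ)), v ∈ R := by
      intro κ
      obtain ⟨i, hi, hiR⟩ := hR (.inr (tailOutIndex κ))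
      simp only [Sum.elim_inr, Finset.mem_map, Finset.mem_univ, true_and] at hi
      obtain ⟨h, rfl⟩ := hi
      exact ⟨_, ⟨_, ⟨h, rfl⟩, rfl⟩, hiR⟩
    rw [← hI]
    exact ⟨hrig.le_shortcutCertComplexity hM hA hB, hrig.le_hopsetCertComplexity hM hA hB⟩

end Counting

end Gadget

/-! ### Choice of parameters -/

section Parameters

theorem half_le_floor {y : ℝ} (hy : 1 ≤ y) : y / 2 ≤ ⌊y⌋₊ := by
  have h1 := Nat.lt_floor_add_one y
  have h2 : (1 : ℝ) ≤ ⌊y⌋₊ := by exact_mod_cast Nat.le_floor (by simpa using hy)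
  linarith

theorem eventually_mul_rpow_le (C : ℝ) {a b : ℝ} (hab : a < b) :
    ∀ᶠ n : ℕ in atTop, C * (n : ℝ) ^ a ≤ (n : ℝ) ^ b := by
  have h := ((tendsto_rpow_atTop (sub_pos.2 hab)).comp
    tendsto_natCast_atTop_atTop).eventually_ge_atTop C
  filter_upwards [h, eventually_gt_atTop 0] with n hn hpos
  have hx : (0 : ℝ) < n := by exact_mod_cast hpos
  calc C * (n : ℝ) ^ a ≤ (n : ℝ) ^ (b - a) * (n : ℝ) ^ a :=
        mul_le_mul_of_nonneg_right hn (Real.rpow_nonneg hx.le _)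
    _ = (n : ℝ) ^ b := by rw [← Real.rpow_add hx, sub_add_cancel]

theorem eventually_mul_log_pow_le (C : ℝ) (k : ℕ) {r : ℝ} (hr : 0 < r) :
    ∀ᶠ n : ℕ in atTop, C * Real.log n ^ k ≤ (n : ℝ) ^ r := by
  have h := (isLittleO_log_rpow_rpow_atTop (k : ℝ) hr).comp_tendsto
    (tendsto_natCast_atTop_atTop (R := ℝ))
  filter_upwards [h.def (c := (|C| + 1)⁻¹) (by positivity), eventually_gt_atTop 0] with n hn hpos
  have hx : (1 : ℝ) ≤ n := by exact_mod_cast hpos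
  have hlog := Real.log_nonneg hx
  simp only [Function.comp_apply, Real.rpow_natCast, norm_pow, Real.norm_eq_abs,
    abs_of_nonneg hlog] at hn
  rw [abs_of_nonneg (Real.rpow_nonneg (by linarith) r), inv_mul_eq_div,
    le_div_iff₀ (by positivity)] at hn
  have h0 : 0 ≤ Real.log n ^ k := by positivity
  nlinarith [le_abs_self C]

/-- The loss exp(-4√log) in Behrend's bound is smaller than any power of n; a factor n^(1/1000) is
allowed for it. -/
theorem eventually_le_rothNumberNat :
    ∀ᶠ n : ℕ in atTop, (n : ℝ) ^ (1 / 2 - 2 / 1000 : ℝ) ≤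
      rothNumberNat ⌊(n : ℝ) ^ (1 / 2 - 1 / 1000 : ℝ)⌋₊ := by
  have hlog : Tendsto (fun n : ℕ => Real.log n) atTop atTop :=
    Real.tendsto_log_atTop.comp tendsto_natCast_atTop_atTop
  -- With √(log n) ≥ 10⁴ one has (log n)/1000 ≥ 10 √(log n), which exceeds 4 √(log n) + log 2.
  filter_upwards [eventually_gt_atTop 0, hlog.eventually_ge_atTop (10 ^ 8)] with n hpos hlogn
  have hx : (1 : ℝ) ≤ n := by exact_mod_cast hpos
  set y : ℝ := (n : ℝ) ^ (1 / 2 - 1 / 1000 : ℝ) with hy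
  have hy1 : 1 ≤ y := Real.one_le_rpow hx (by norm_num)
  have hyn : y ≤ n := by
    calc y ≤ (n : ℝ) ^ (1 : ℝ) := Real.rpow_le_rpow_of_exponent_le hx (by norm_num)
      _ = n := Real.rpow_one _
  have hfl : (1 : ℝ) ≤ ⌊y⌋₊ := by exact_mod_cast Nat.le_floor (by simpa using hy1)
  have hfn : (⌊y⌋₊ : ℝ) ≤ n := (Nat.floor_le (by linarith)).trans hyn
  have hsq : √(Real.log ⌊y⌋₊) ≤ √(Real.log n) :=
    Real.sqrt_le_sqrt (Real.log_le_log (by linarith) hfn)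
  have hs : (10 : ℝ) ^ 4 ≤ √(Real.log n) := by
    apply Real.le_sqrt_of_sq_le
    norm_num at hlogn ⊢
    exact hlogn
  have hss : √(Real.log n) ^ 2 = Real.log n := Real.sq_sqrt (by linarith)
  refine le_trans ?_ Behrend.roth_lower_bound
  have h2 : (1 / 2 : ℝ) = Real.exp (-Real.log 2) := by
    rw [Real.exp_neg, Real.exp_log (by norm_num)]
    norm_num
  calc (n : ℝ) ^ (1 / 2 - 2 / 1000 : ℝ) = y * (n : ℝ) ^ (-(1 / 1000) : ℝ) := by
        rw [hy, ← Real.rpow_add (by linarith)]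
        norm_num
    _ ≤ y * (1 / 2 * Real.exp (-4 * √(Real.log n))) := by
        refine mul_le_mul_of_nonneg_left ?_ (by linarith)
        rw [Real.rpow_def_of_pos (by linarith), h2, ← Real.exp_add, Real.exp_le_exp]
        have := Real.log_two_lt_d9
        nlinarith
    _ = y / 2 * Real.exp (-4 * √(Real.log n)) := by ring
    _ ≤ ⌊y⌋₊ * Real.exp (-4 * √(Real.log ⌊y⌋₊)) := by
        refine mul_le_mul (half_le_floor hy1) (Real.exp_le_exp.2 (by linarith)) (by positivity)
          (by positivity)

/-- Multiplied by J², the core size involves the number γ · 2L³J⁶ of ports, which is at most 2B.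
This gives 12 x z², and dividing by J² ≥ 49 z² leaves 12/49 < 1/4; hence the factor 7 in J. -/
theorem core_size_le {N B γ L J x z : ℝ} (hN : 0 ≤ N) (hγ : 0 ≤ γ) (hL : 1 ≤ L)
    (hx : 0 ≤ x) (hz : 0 < z) (hJz : 7 * z ≤ J)
    (hγB : γ * (2 * L ^ 3 * J ^ 6) ≤ 2 * B) (hLNB : L * (N * B) ≤ 2 * (x * z ^ 2)) :
    N * γ * (2 * L + 1) * (2 * L ^ 3 * J ^ 4) ≤ x / 4 := by
  have hL0 : 0 ≤ L := by linarith
  have e1 : N * γ * (2 * L + 1) * (2 * L ^ 3 * J ^ 4) * J ^ 2 ≤ 12 * (x * z ^ 2) := by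
    calc N * γ * (2 * L + 1) * (2 * L ^ 3 * J ^ 4) * J ^ 2
        = N * (2 * L + 1) * (γ * (2 * L ^ 3 * J ^ 6)) := by ring
      _ ≤ N * (3 * L) * (2 * B) := by
          refine mul_le_mul (mul_le_mul_of_nonneg_left (by linarith) hN) hγB (by positivity)
            (by positivity)
      _ = 6 * (L * (N * B)) := by ring
      _ ≤ 12 * (x * z ^ 2) := by linarith
  have e2 : N * γ * (2 * L + 1) * (2 * L ^ 3 * J ^ 4) * 49 * z ^ 2 ≤ 12 * x * z ^ 2 := by
    calc N * γ * (2 * L + 1) * (2 * L ^ 3 * J ^ 4) * 49 * z ^ 2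
        = N * γ * (2 * L + 1) * (2 * L ^ 3 * J ^ 4) * (7 * z) ^ 2 := by ring
      _ ≤ N * γ * (2 * L + 1) * (2 * L ^ 3 * J ^ 4) * J ^ 2 :=
          mul_le_mul_of_nonneg_left (pow_le_pow_left₀ (by positivity) hJz 2) (by positivity)
      _ ≤ 12 * x * z ^ 2 := by linarith
  have e3 := le_of_mul_le_mul_right e2 (by positivity)
  linarith

/-- The tails use 5Nτ ≤ 5n^(1-1/2000) vertices; L is the least number of layers with L N|A| ≥
n^(1+2ε), and J is about 7n^ε. Hypothesis `h2` makes the ports of one copy at most |A|; it holds for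
large n when 12ε + 12/1000 < 1/2 - 2/1000, which is where ε < 1/25 is used. -/
theorem exists_gadget {ε : ℝ} (hε : 0 ≤ ε) {n : ℕ} (hn : 0 < n)
    (h1 : (n : ℝ) ^ (1 / 2 - 2 / 1000 : ℝ) ≤
      rothNumberNat ⌊(n : ℝ) ^ (1 / 2 - 1 / 1000 : ℝ)⌋₊)
    (h2 : 2 ^ 22 * (n : ℝ) ^ (12 * ε + 12 / 1000) ≤ (n : ℝ) ^ (1 / 2 - 2 / 1000 : ℝ))
    (h3 : 20 * (n : ℝ) ^ (1 - 1 / 2000 : ℝ) ≤ (n : ℝ) ^ (1 : ℝ))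
    (h4 : 8 * (n : ℝ) ^ ((1 + ε) / 2) ≤ (n : ℝ) ^ (1 : ℝ)) :
    ∃ P : Gadget, P.size ≤ n ∧ 5 * P.N ≤ n ∧ (P.arcBound : ℝ) ≤ 6 * (n : ℝ) ^ (1 + ε) ∧
      1 / 4 * (n : ℝ) ^ (1 + ε) ≤ P.q ^ 2 ∧
      (n : ℝ) ^ (1 / 2 + 1 / 2000 : ℝ) / 2 ≤ P.τ ∧
      (n : ℝ) ^ (1 + 2 * ε) ≤ (P.N * P.A.card * (2 * P.L - 1) : ℕ) := by
  have hx : (1 : ℝ) ≤ n := by exact_mod_cast hn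
  have hx0 : (0 : ℝ) < n := by linarith
  rw [Real.rpow_one] at h3 h4
  set x : ℝ := (n : ℝ) with hxn
  set N := ⌊x ^ (1 / 2 - 1 / 1000 : ℝ)⌋₊ with hN
  set τ := ⌊x ^ (1 / 2 + 1 / 2000 : ℝ)⌋₊ with hτ
  set q := ⌊x ^ ((1 + ε) / 2)⌋₊ with hq
  obtain ⟨A, hA, hAcard, hAfree⟩ := rothNumberNat_spec N
  set B := rothNumberNat N with hB
  have hNle : (N : ℝ) ≤ x ^ (1 / 2 - 1 / 1000 : ℝ) := Nat.floor_le (by positivity)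
  have hBN : B ≤ N := rothNumberNat_le N
  have hBN' : (B : ℝ) ≤ N := by exact_mod_cast hBN
  have hB1 : (1 : ℝ) ≤ B := (Real.one_le_rpow hx (by norm_num)).trans h1
  have hBpos : 0 < B := by exact_mod_cast (by linarith : (0 : ℝ) < B)
  have hNpos : 0 < N := by omega
  -- the product of the two parameters of the tails
  have hNBlow : x ^ (1 - 4 / 1000 : ℝ) ≤ N * B := by
    calc x ^ (1 - 4 / 1000 : ℝ) = x ^ (1 / 2 - 2 / 1000 : ℝ) * x ^ (1 / 2 - 2 / 1000 : ℝ) := by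
          rw [← Real.rpow_add hx0]
          norm_num
      _ ≤ N * B := mul_le_mul (h1.trans hBN') h1 (by positivity) (by positivity)
  have hNBhigh : (N : ℝ) * B ≤ x := by
    calc (N : ℝ) * B ≤ x ^ (1 / 2 - 1 / 1000 : ℝ) * x ^ (1 / 2 - 1 / 1000 : ℝ) :=
          mul_le_mul hNle (hBN'.trans hNle) (by positivity) (by positivity)
      _ = x ^ (1 - 2 / 1000 : ℝ) := by
          rw [← Real.rpow_add hx0]
          norm_num
      _ ≤ x ^ (1 : ℝ) := Real.rpow_le_rpow_of_exponent_le hx (by norm_num)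
      _ = x := Real.rpow_one x
  have hNBpos : (0 : ℝ) < N * B := by positivity
  set z := x ^ ε with hz
  have hz1 : 1 ≤ z := Real.one_le_rpow hx hε
  have hD : x ^ (1 + 2 * ε) = x * z ^ 2 := by
    rw [Real.rpow_add hx0, Real.rpow_one, hz, ← Real.rpow_natCast (x ^ ε), ← Real.rpow_mul hx0.le,
      mul_comm (2 : ℝ) ε]
    norm_num
  have hxz : x ^ (1 + ε) = x * z := by rw [Real.rpow_add hx0, Real.rpow_one]
  -- the number of layers
  set L := ⌈x ^ (1 + 2 * ε) / (N * B)⌉₊ with hL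
  have hLpos : 0 < L := Nat.ceil_pos.2 (by positivity)
  have hL1 : (1 : ℝ) ≤ L := by exact_mod_cast hLpos
  have hLlow : x ^ (1 + 2 * ε) ≤ L * (N * B) := (div_le_iff₀ hNBpos).1 (Nat.le_ceil _)
  have hLhigh : (L : ℝ) ≤ x ^ (1 + 2 * ε) / (N * B) + 1 := (Nat.ceil_lt_add_one (by positivity)).le
  have hLNB : L * (N * B) ≤ 2 * (x * z ^ 2) := by
    have h := mul_le_mul_of_nonneg_right hLhigh hNBpos.le
    rw [add_mul, div_mul_cancel₀ _ hNBpos.ne', hD] at h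
    have : x * 1 ≤ x * z ^ 2 := mul_le_mul_of_nonneg_left (one_le_pow₀ hz1) hx0.le
    linarith
  set y := x ^ (2 * ε + 4 / 1000) with hy
  have hy1 : 1 ≤ y := Real.one_le_rpow hx (by positivity)
  have hLy : (L : ℝ) ≤ 2 * y := by
    have : x ^ (1 + 2 * ε) / (N * B) ≤ y := by
      rw [div_le_iff₀ hNBpos]
      calc x ^ (1 + 2 * ε) = y * x ^ (1 - 4 / 1000 : ℝ) := by
            rw [hy, ← Real.rpow_add hx0]
            congr 1
            ring
        _ ≤ y * (N * B) := mul_le_mul_of_nonneg_left hNBlow (by positivity)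
    linarith
  -- the number of slopes
  set J := ⌈7 * z⌉₊ with hJ
  have hJlow : 7 * z ≤ J := Nat.le_ceil _
  have hJhigh : (J : ℝ) ≤ 8 * z := by
    have := (Nat.ceil_lt_add_one (a := 7 * z) (by positivity)).le
    linarith
  have hJpos : 0 < J := Nat.ceil_pos.2 (by positivity)
  have hP0 : 2 * L ^ 3 * J ^ 6 ≤ B := by
    have : (2 : ℝ) * L ^ 3 * J ^ 6 ≤ B := by
      calc (2 : ℝ) * L ^ 3 * J ^ 6 ≤ 2 * (2 * y) ^ 3 * (8 * z) ^ 6 := by gcongr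
        _ = 2 ^ 22 * (y ^ 3 * z ^ 6) := by ring
        _ = 2 ^ 22 * x ^ (12 * ε + 12 / 1000) := by
            rw [hy, hz, ← Real.rpow_natCast (x ^ (2 * ε + 4 / 1000)), ← Real.rpow_natCast (x ^ ε),
              ← Real.rpow_mul hx0.le, ← Real.rpow_mul hx0.le, ← Real.rpow_add hx0]
            congr 2
            push_cast
            ring
        _ ≤ B := h2.trans h1
    exact_mod_cast this
  set P₀ := 2 * L ^ 3 * J ^ 6 with hP₀
  have hP₀pos : 0 < P₀ := by positivity
  -- the number of copies of the core layers
  set γ := B / P₀ + 1 with hγ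
  have hγlow : B ≤ γ * P₀ := by
    have := Nat.lt_div_mul_add (a := B) hP₀pos
    rw [hγ, add_mul, one_mul]
    exact this.le
  -- Rounding up the number of copies costs at most a factor 2 because `P₀ ≤ B`.
  have hγhigh : γ * P₀ ≤ 2 * B := by
    have := Nat.div_mul_le_self B P₀
    rw [hγ, add_mul, one_mul]
    omega
  have : NeZero L := ⟨hLpos.ne'⟩
  have : NeZero J := ⟨hJpos.ne'⟩
  obtain ⟨port⟩ : Nonempty (A ↪ Fin γ × CoreGroup L J × Fin J × Fin J) := by
    apply Function.Embedding.nonempty_of_card_le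
    simp only [Fintype.card_coe, Fintype.card_prod, Fintype.card_fin, ZMod.card, hAcard]
    refine hγlow.trans (le_of_eq ?_)
    rw [hP₀]
    ring
  have hτ1 : 1 ≤ x ^ (1 / 2 + 1 / 2000 : ℝ) := Real.one_le_rpow hx (by norm_num)
  have hτle : (τ : ℝ) ≤ x ^ (1 / 2 + 1 / 2000 : ℝ) := Nat.floor_le (by positivity)
  have hτpos : 0 < τ := Nat.floor_pos.2 hτ1
  have hq1 : 1 ≤ x ^ ((1 + ε) / 2) := Real.one_le_rpow hx (by positivity)
  have hqle : (q : ℝ) ≤ x ^ ((1 + ε) / 2) := Nat.floor_le (by positivity)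
  have hqsq : (x ^ ((1 + ε) / 2)) ^ 2 = x * z := by
    rw [← hxz, ← Real.rpow_natCast, ← Real.rpow_mul hx0.le]
    norm_num
  have htails : (5 : ℝ) * N * τ ≤ x / 4 := by
    have : (N : ℝ) * τ ≤ x ^ (1 - 1 / 2000 : ℝ) := by
      calc (N : ℝ) * τ ≤ x ^ (1 / 2 - 1 / 1000 : ℝ) * x ^ (1 / 2 + 1 / 2000 : ℝ) :=
            mul_le_mul hNle hτle (by positivity) (by positivity)
        _ = x ^ (1 - 1 / 2000 : ℝ) := by
            rw [← Real.rpow_add hx0]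
            norm_num
    linarith
  have hcore : (N : ℝ) * γ * (2 * L + 1) * (2 * L ^ 3 * J ^ 4) ≤ x / 4 :=
    core_size_le (by positivity) (by positivity) hL1 hx0.le
      (by linarith) hJlow (by exact_mod_cast hγhigh) hLNB
  have hpad : (2 : ℝ) * q ≤ x / 4 := by linarith
  have hsize : 5 * N * τ + N * γ * (2 * L + 1) * (2 * L ^ 3 * J ^ 4) + 2 * q ≤ n := by
    have : (5 : ℝ) * N * τ + N * γ * (2 * L + 1) * (2 * L ^ 3 * J ^ 4) + 2 * q ≤ n := by linarith
    exact_mod_cast this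
  refine ⟨⟨N, τ, L, J, γ, q, A, hτpos, hLpos, hJpos, fun a ha => Finset.mem_range.1 (hA ha), hAfree,
    port, port.injective⟩, hsize, ?_, ?_, ?_, half_le_floor hτ1, ?_⟩
  · change 5 * N ≤ n
    have : 5 * N * 1 ≤ 5 * N * τ := Nat.mul_le_mul_left _ hτpos
    omega
  -- In units of n^(1+ε): tails 1/4, core (1/4) · 8 = 2, connecting arcs 2, padding 1, in total
  -- below 6.
  · simp only [Gadget.arcBound, hAcard]
    push_cast
    have e1 := mul_le_mul hcore hJhigh (by positivity) (by positivity)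
    have e2 : (q : ℝ) ^ 2 ≤ x * z := hqsq ▸ pow_le_pow_left₀ (by positivity) hqle 2
    have e3 : x * 1 ≤ x * z := mul_le_mul_of_nonneg_left hz1 hx0.le
    rw [hxz]
    linarith
  · change 1 / 4 * x ^ (1 + ε) ≤ (q : ℝ) ^ 2
    rw [hxz, ← hqsq]
    calc 1 / 4 * (x ^ ((1 + ε) / 2)) ^ 2 = (x ^ ((1 + ε) / 2) / 2) ^ 2 := by ring
      _ ≤ (q : ℝ) ^ 2 := by
        have := half_le_floor hq1
        gcongr
  · simp only [hAcard]
    refine hLlow.trans ?_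
    have : L * (N * B) ≤ N * B * (2 * L - 1) := by
      rw [mul_comm]
      exact Nat.mul_le_mul_left _ (by omega)
    exact_mod_cast this

end Parameters

/-! ### Asymptotics and high probability -/

section Asymptotics

/-- Up to a constant, p is at least n^(-1/2) over a power of log n, and the surplus n^(1/2000) in
the tail length absorbs all logarithms. -/
theorem IsSoftTheta.eventually_log_le {p : ℕ → unitInterval}
    (hp : IsSoftTheta (fun n => (p n : ℝ)) (fun n => (n : ℝ) ^ (-(1 / 2) : ℝ))) (a : ℕ) :
    ∀ᶠ n : ℕ in atTop,
      (a + 1) * Real.log n ≤ p n * ((n : ℝ) ^ (1 / 2 + 1 / 2000 : ℝ) / 2) := by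
  obtain ⟨k, -, hO⟩ := hp
  obtain ⟨C, hC, hbound⟩ := hO.exists_pos
  filter_upwards [hbound.bound, eventually_gt_atTop 1,
    eventually_mul_log_pow_le (2 * C * (a + 1)) (k + 1) (r := 1 / 2000) (by norm_num)]
    with n h1 hn h2
  have hx : (1 : ℝ) < n := by exact_mod_cast hn
  have hx0 : (0 : ℝ) < n := by linarith
  have hlog : 0 < Real.log n := Real.log_pos hx
  have hp0 : 0 ≤ (p n : ℝ) := (p n).2.1
  rw [Real.norm_of_nonneg (by positivity), Real.norm_of_nonneg (by positivity)] at h1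
  have h3 : (n : ℝ) ^ (1 / 2000 : ℝ) ≤
      C * (p n * Real.log n ^ k) * (n : ℝ) ^ (1 / 2 + 1 / 2000 : ℝ) := by
    calc (n : ℝ) ^ (1 / 2000 : ℝ)
        = (n : ℝ) ^ (-(1 / 2) : ℝ) * (n : ℝ) ^ (1 / 2 + 1 / 2000 : ℝ) := by
          rw [← Real.rpow_add hx0]
          norm_num
      _ ≤ _ := mul_le_mul_of_nonneg_right h1 (by positivity)
  have h4 : ((a + 1) * Real.log n) * (2 * C * Real.log n ^ k) ≤
      (p n * ((n : ℝ) ^ (1 / 2 + 1 / 2000 : ℝ) / 2)) * (2 * C * Real.log n ^ k) := by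
    rw [pow_succ] at h2
    linarith
  exact le_of_mul_le_mul_right h4 (by positivity)

/-- One tail is missed with probability at most exp(-pτ) ≤ n^(-a-1); the union bound over at most n
tails loses a factor n. -/
theorem mul_one_sub_pow_le {n m τ a : ℕ} (hn : 0 < n) (hm : m ≤ n) {p : ℝ}
    (hp1 : p ≤ 1) (h : (a + 1) * Real.log n ≤ p * τ) :
    m * (1 - p) ^ τ ≤ ((n : ℝ) ^ a)⁻¹ := by
  have hx : (0 : ℝ) < n := by exact_mod_cast hn
  have h1 : (1 - p) ^ τ ≤ ((n : ℝ) ^ (a + 1))⁻¹ := by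
    calc (1 - p) ^ τ ≤ Real.exp (-p) ^ τ :=
          pow_le_pow_left₀ (by linarith) (Real.one_sub_le_exp_neg p) τ
      _ = Real.exp (-(p * τ)) := by
          rw [← Real.exp_nat_mul]
          congr 1
          ring
      _ ≤ Real.exp (-((a + 1) * Real.log n)) := Real.exp_le_exp.2 (by linarith)
      _ = ((n : ℝ) ^ (a + 1))⁻¹ := by
          rw [Real.exp_neg, ← Real.exp_log (pow_pos hx (a + 1)), Real.log_pow]
          push_cast
          rfl
  calc m * (1 - p) ^ τ ≤ n * ((n : ℝ) ^ (a + 1))⁻¹ :=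
        mul_le_mul (by exact_mod_cast hm) h1 (pow_nonneg (by linarith) _) hx.le
    _ = ((n : ℝ) ^ a)⁻¹ := by
        rw [pow_succ]
        field_simp

/-- The properties of the graph on `n` vertices that yield both parts of the theorem. -/
def IsHard (ε : ℝ) (n : ℕ) (G : Digraph (Fin n)) : Prop :=
  1 / 4 * (n : ℝ) ^ (1 + ε) ≤ numArcs G ∧ (numArcs G : ℝ) ≤ 6 * (n : ℝ) ^ (1 + ε) ∧
  ∃ (N τ : ℕ) (U : Fin (2 * N) ⊕ Fin (3 * N) → Finset (Fin n)), 5 * N ≤ n ∧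
    (n : ℝ) ^ (1 / 2 + 1 / 2000 : ℝ) / 2 ≤ τ ∧ (∀ j, (U j).card = τ) ∧
    ∀ R : Set (Fin n), (∀ j, ∃ i ∈ U j, i ∈ R) →
      (n : ℝ) ^ (1 + 2 * ε) ≤ shortcutCertComplexity G (samplingShortcut G R) ∧
      (n : ℝ) ^ (1 + 2 * ε) ≤ hopsetCertComplexity (SimpleGraph.fromRel G.Adj)
        (samplingHopset (SimpleGraph.fromRel G.Adj) R)

theorem exists_isHard {ε : ℝ} (hε₀ : 0 ≤ ε) (hε₁ : ε < 1 / 25) :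
    ∃ (G : ∀ n, Digraph (Fin n)) (lev : ∀ n, Fin n → ℕ), (∀ n, IsLevelling (G n) (lev n)) ∧
      ∀ᶠ n : ℕ in atTop, IsHard ε n (G n) := by
  have hev : ∀ᶠ n : ℕ in atTop, ∃ (G : Digraph (Fin n)) (lev : Fin n → ℕ),
      IsLevelling G lev ∧ IsHard ε n G := by
    filter_upwards [eventually_gt_atTop 0, eventually_le_rothNumberNat,
      eventually_mul_rpow_le (2 ^ 22) (a := 12 * ε + 12 / 1000) (b := 1 / 2 - 2 / 1000)
        (by linarith),
      eventually_mul_rpow_le 20 (a := 1 - 1 / 2000) (b := 1) (by norm_num),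
      eventually_mul_rpow_le 8 (a := (1 + ε) / 2) (b := 1) (by linarith)] with n hn h1 h2 h3 h4
    obtain ⟨P, hsize, hN, harc, hq, hτ, hcost⟩ := exists_gadget hε₀ hn h1 h2 h3 h4
    obtain ⟨G, lev, U, hl, hlow, hhigh, hU, hR⟩ := P.exists_digraph hsize
    refine ⟨G, lev, hl, hq.trans (by exact_mod_cast hlow),
      le_trans (by exact_mod_cast hhigh) harc, P.N, P.τ, U, hN, hτ, hU, fun R h => ?_⟩
    obtain ⟨hs, hh⟩ := hR R h
    exact ⟨hcost.trans (by exact_mod_cast hs), hcost.trans (by exact_mod_cast hh)⟩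
  -- A levelling is needed for every n, so the empty graph is used for those n where the
  -- construction is unavailable.
  have hall : ∀ n : ℕ, ∃ (G : Digraph (Fin n)) (lev : Fin n → ℕ), IsLevelling G lev ∧
      ((∃ (G : Digraph (Fin n)) (lev : Fin n → ℕ), IsLevelling G lev ∧ IsHard ε n G) →
        IsHard ε n G) := by
    intro n
    by_cases h : ∃ (G : Digraph (Fin n)) (lev : Fin n → ℕ), IsLevelling G lev ∧ IsHard ε n G
    · obtain ⟨G, lev, hl, hG⟩ := h
      exact ⟨G, lev, hl, fun _ => hG⟩
    · exact ⟨⊥, 0, fun _ _ h => h.elim, fun h' => absurd h' h⟩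
  choose G lev hl hG using hall
  exact ⟨G, lev, hl, hev.mono fun n hn => hG n hn⟩

theorem isTheta_rpow_of_isHard {ε : ℝ} {G : ∀ n, Digraph (Fin n)}
    (hG : ∀ᶠ n : ℕ in atTop, IsHard ε n (G n)) :
    (fun n : ℕ => (numArcs (G n) : ℝ)) =Θ[atTop] (fun n : ℕ => (n : ℝ) ^ (1 + ε)) := by
  constructor
  · refine IsBigO.of_bound 6 (hG.mono fun n hn => ?_)
    rw [Real.norm_of_nonneg (by positivity), Real.norm_of_nonneg (by positivity)]
    exact hn.2.1
  · refine IsBigO.of_bound 4 (hG.mono fun n hn => ?_)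
    rw [Real.norm_of_nonneg (by positivity), Real.norm_of_nonneg (by positivity)]
    linarith [hn.1]

theorem sampledWHP_of_isHard {ε : ℝ} {G : ∀ n, Digraph (Fin n)}
    (hG : ∀ᶠ n : ℕ in atTop, IsHard ε n (G n)) {p : ℕ → unitInterval}
    (hp : IsSoftTheta (fun n => (p n : ℝ)) (fun n => (n : ℝ) ^ (-(1 / 2) : ℝ))) :
    SampledWHP p (fun n => {R : Set (Fin n) |
      1 / 6 * (numArcs (G n) * (n : ℝ) ^ ε) ≤
          shortcutCertComplexity (G n) (samplingShortcut (G n) R) ∧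
        1 / 6 * (numArcs (G n) * (n : ℝ) ^ ε) ≤
          hopsetCertComplexity (SimpleGraph.fromRel (G n).Adj)
            (samplingHopset (SimpleGraph.fromRel (G n).Adj) R)}) := by
  intro a
  filter_upwards [hG, eventually_gt_atTop 0, hp.eventually_log_le a]
    with n hGn hn hlog
  obtain ⟨-, hhigh, N, τ, U, hN, hτ, hU, hR⟩ := hGn
  have hx : (0 : ℝ) < n := by exact_mod_cast hn
  have hp0 : 0 ≤ (p n : ℝ) := (p n).2.1
  -- The constant 1/6 cancels the factor 6 in the upper bound on the number of arcs.
  have hm : 1 / 6 * (numArcs (G n) * (n : ℝ) ^ ε) ≤ (n : ℝ) ^ (1 + 2 * ε) := by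
    calc 1 / 6 * (numArcs (G n) * (n : ℝ) ^ ε) = 1 / 6 * numArcs (G n) * (n : ℝ) ^ ε := by ring
      _ ≤ (n : ℝ) ^ (1 + ε) * (n : ℝ) ^ ε := by
          refine mul_le_mul_of_nonneg_right (by linarith) (by positivity)
      _ = (n : ℝ) ^ (1 + 2 * ε) := by
          rw [← Real.rpow_add hx]
          congr 1
          ring
  refine le_trans ?_ (one_sub_le_setBernoulli_hit (p n) U (fun j => (hU j).ge)
    fun R h => ⟨hm.trans (hR R h).1, hm.trans (hR R h).2⟩)
  have hcard : Fintype.card (Fin (2 * N) ⊕ Fin (3 * N)) ≤ n := by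
    rw [Fintype.card_sum, Fintype.card_fin, Fintype.card_fin]
    omega
  have := mul_one_sub_pow_le hn hcard (p n).2.2
    (hlog.trans (mul_le_mul_of_nonneg_left hτ hp0))
  linarith

theorem SampledWHP.mono {p : ℕ → unitInterval} {A B : ∀ n : ℕ, Set (Set (Fin n))}
    (hA : SampledWHP p A) (hAB : ∀ n, A n ⊆ B n) : SampledWHP p B :=
  fun a => (hA a).mono fun n hn => hn.trans (MeasureTheory.measureReal_mono (hAB n))

end Asymptotics

end Certification

theorem mainTheorem7 (ε : ℝ) (hε₀ : 0 ≤ ε) (hε₁ : ε < 1 / 25) :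
    (∃ G : ∀ n : ℕ, Digraph (Fin n),
      (∀ n, Certification.IsDAG (G n)) ∧
      (fun n : ℕ => (Certification.numArcs (G n) : ℝ)) =Θ[atTop] (fun n : ℕ => (n : ℝ) ^ (1 + ε)) ∧
      ∃ c : ℝ, 0 < c ∧ ∀ p : ℕ → unitInterval,
        Certification.IsSoftTheta (fun n => (p n : ℝ)) (fun n => (n : ℝ) ^ (-(1 / 2) : ℝ)) →
        Certification.SampledWHP p (fun n => {R : Set (Fin n) |
          c * (Certification.numArcs (G n) * (n : ℝ) ^ ε) ≤
            (Certification.shortcutCertComplexity (G n)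
              (Certification.samplingShortcut (G n) R) : ℝ)})) ∧
    (∃ G : ∀ n : ℕ, SimpleGraph (Fin n),
      (fun n : ℕ => ((G n).edgeSet.ncard : ℝ)) =Θ[atTop] (fun n : ℕ => (n : ℝ) ^ (1 + ε)) ∧
      ∃ c : ℝ, 0 < c ∧ ∀ p : ℕ → unitInterval,
        Certification.IsSoftTheta (fun n => (p n : ℝ)) (fun n => (n : ℝ) ^ (-(1 / 2) : ℝ)) →
        Certification.SampledWHP p (fun n => {R : Set (Fin n) |
          c * ((G n).edgeSet.ncard * (n : ℝ) ^ ε) ≤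
            (Certification.hopsetCertComplexity (G n)
              (Certification.samplingHopset (G n) R) : ℝ)})) := by
  obtain ⟨G, lev, hl, hG⟩ := Certification.exists_isHard hε₀ hε₁
  have hΘ := Certification.isTheta_rpow_of_isHard hG
  refine ⟨⟨G, fun n => (hl n).isDAG, hΘ, 1 / 6, by norm_num, fun p hp =>
    (Certification.sampledWHP_of_isHard hG hp).mono fun n R h => h.1⟩,
    ⟨fun n => SimpleGraph.fromRel (G n).Adj, ?_, 1 / 6, by norm_num, fun p hp =>
    (Certification.sampledWHP_of_isHard hG hp).mono fun n R h => ?_⟩⟩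
  -- Part (2) uses the same graphs without directions; a levelled digraph has no opposite arcs, so
  -- the edge count is unchanged.
  · simpa only [(hl _).numArcs_eq] using hΘ
  · rw [Set.mem_ofPred_eq, ← (hl n).numArcs_eq]
    exact h.2
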